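/- Let $V$ be a simple Euclidean Jordan algebra of dimension $n$ and rank $r$, with its (associative) scalar product and the corresponding Lebesgue measure, let $\Omega\subset V$ be its irreducible symmetric cone (the interior of the set of squares of $V$), let $\Delta$ be the determinant function of $V$, and let $T_\Omega=V+i\Omega$ be the tube domain over $\Omega$ in the complexification of $V$. The Hardy space $H^2(T_\Omega)$ consists of the holomorphic functions $F$ on $T_\Omega$ with $$\|F\|_{H^2(T_\Omega)}:=\Big(\sup_{y\in\Omega}\int_V|F(x+iy)|^2\,dx\Big)^{1/2}<\infty .$$ A positive Borel measure $\mu$ on $T_\Omega$ is called a Carleson measure for $H^2(T_\Omega)$ if there is a constant $C>0$ such that $\int_{T_\Omega}|F(z)|^2\,d\mu(z)\le C\,\|F\|^2_{H^2(T_\Omega)}$ for every $F\in H^2(T_\Omega)$. Let $\varphi$ be a nonnegative real-valued (Lebesgue) measurable function on $\Omega$. Then the following assertions are equivalent. 1. The measure $d\mu(x+iy)=dx\,\varphi(y)\,dy$ is a Carleson measure for $H^2(T_\Omega)$. 2. The function $\varphi$ is integrable on $\Omega$. 3. For some $\alpha>\frac nr-\frac12$ there is a constant $C>0$ such that $$\int_\Omega\Delta^{-2\alpha+\frac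 nr}(y+t)\,\varphi(y)\,dy\le C\,\Delta^{-2\alpha+\frac nr}(t)\qquad\text{for every } t\in\Omega. \tag{$*$}$$ 4. For every $\alpha>\frac nr-\frac12$ there is a constant $C>0$ (possibly depending on $\alpha$) such that $(*)$ holds. -/

import Mathlib

open MeasureTheory Module
open scoped ENNReal

noncomputable section

/-- A Euclidean Jordan algebra structure on a real inner product space `V`: a bilinear commutative
product with identity element, satisfying the Jordan identity `x² (x y) = x (x² y)`, for which the
inner product of `V` is associative: `⟪x y, z⟫ = ⟪y, x z⟫`. -/
structure EuclideanJordanAlgebra (V : Type*) [NormedAddCommGroup V] [InnerProductSpace ℝ V] where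
  mul : V →ₗ[ℝ] V →ₗ[ℝ] V
  one : V
  mul_comm : ∀ x y, mul x y = mul y x
  one_mul : ∀ x, mul one x = x
  jordan : ∀ x y, mul (mul x x) (mul x y) = mul x (mul (mul x x) y)
  inner_mul : ∀ x y z, inner ℝ (mul x y) z = inner ℝ y (mul x z)

namespace EuclideanJordanAlgebra

variable {V : Type*} [NormedAddCommGroup V] [InnerProductSpace ℝ V]
variable (J : EuclideanJordanAlgebra V)

/-- The algebra is simple: it is nonzero and has no ideals besides `0` and `V`. -/
def IsSimple : Prop :=
  Nontrivial V ∧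
    ∀ I : Submodule ℝ V, (∀ x, ∀ y ∈ I, J.mul x y ∈ I) → I = ⊥ ∨ I = ⊤

/-- The symmetric cone of the algebra: the interior of the set of squares. It is an irreducible
cone exactly when the algebra is simple. -/
def cone : Set V := interior (Set.range fun x => J.mul x x)

/-- The powers `x⁰ = e`, `xᵏ⁺¹ = x xᵏ`. -/
def pow (x : V) : ℕ → V
  | 0 => J.one
  | k + 1 => J.mul x (pow x k)

/-- The value `q(x) = ∑ₖ qₖ xᵏ` of a real polynomial at an element of the algebra. -/
def evalAt (x : V) (q : Polynomial ℝ) : V := q.sum fun k a => a • J.pow x k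

/-- `q` is the minimal polynomial of `x`. -/
def IsMinpoly (x : V) (q : Polynomial ℝ) : Prop :=
  q.Monic ∧ J.evalAt x q = 0 ∧
    ∀ p : Polynomial ℝ, p.Monic → J.evalAt x p = 0 → q.natDegree ≤ p.natDegree

/-- The degree of the minimal polynomial of `x`. -/
def degree (x : V) : ℕ :=
  sInf {k | ∃ q : Polynomial ℝ, q.Monic ∧ J.evalAt x q = 0 ∧ q.natDegree = k}

/-- The rank of the algebra (and of its cone): the largest degree of a minimal polynomial.
In finite dimension these degrees are bounded by the dimension. -/
def rank : ℕ := sSup (Set.range J.degree)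

/-- `x` is regular: its minimal polynomial has the largest possible degree. -/
def IsRegular (x : V) : Prop := J.degree x = J.rank

/-- `D` is a polynomial function on the finite-dimensional space `V`, i.e. a polynomial in the
coordinates with respect to a basis. -/
def IsPolynomialFunction [FiniteDimensional ℝ V] (D : V → ℝ) : Prop :=
  ∃ P : MvPolynomial (Fin (finrank ℝ V)) ℝ,
    ∀ x, D x = MvPolynomial.eval (fun i => (stdOrthonormalBasis ℝ V).repr x i) P

/-- `D` is the polynomial function whose value at every regular element `x` is `(-1)ʳ` times the
constant coefficient of the minimal polynomial of `x`, with `r` the rank. -/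
def IsDeterminant [FiniteDimensional ℝ V] (D : V → ℝ) : Prop :=
  IsPolynomialFunction D ∧
    ∀ x, J.IsRegular x → ∀ q, J.IsMinpoly x q → D x = (-1) ^ J.rank * q.coeff 0

open Classical in
/-- The determinant function `Δ` of the algebra. In a Euclidean Jordan algebra there is exactly one
function as in `IsDeterminant`, the regular elements being dense. -/
def det [FiniteDimensional ℝ V] : V → ℝ :=
  if h : ∃ D, J.IsDeterminant D then h.choose else 0

end EuclideanJordanAlgebra

section Tube

variable {V : Type*} [NormedAddCommGroup V] [InnerProductSpace ℝ V]

/-- The tube domain `V + iΩ` over `Ω`. The complexification of `V` is realised as `V × V`, the pair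
`(x, y)` standing for `x + iy`. -/
def tube (Ω : Set V) : Set (V × V) := Set.univ ×ˢ Ω

/-- `F` is holomorphic on the subset `T` of the complexification of `V` (open in the uses below):
it is real differentiable at the points of `T`, with complex-linear differential; note that
`i (u + iv) = -v + iu`. -/
def IsHolomorphicOn (F : V × V → ℂ) (T : Set (V × V)) : Prop :=
  ∀ z ∈ T, DifferentiableAt ℝ F z ∧
    ∀ u v : V, fderiv ℝ F z (-v, u) = Complex.I * fderiv ℝ F z (u, v)

variable [FiniteDimensional ℝ V] [MeasurableSpace V] [BorelSpace V]

/-- The norm `(sup_{y ∈ Ω} ∫ |F(x + iy)|² dx)^{1/2}` of the Hardy space `H²(V + iΩ)`, with value `∞`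
when the supremum is infinite. -/
def hardyNorm (Ω : Set V) (F : V × V → ℂ) : ℝ≥0∞ :=
  (⨆ y ∈ Ω, ∫⁻ x, ‖F (x, y)‖ₑ ^ 2) ^ (1 / 2 : ℝ)

/-- `F` belongs to the Hardy space `H²(V + iΩ)`. -/
def MemHardy (Ω : Set V) (F : V × V → ℂ) : Prop :=
  IsHolomorphicOn F (tube Ω) ∧ hardyNorm Ω F < ∞

/-- `μ`, a Borel measure on the tube `V + iΩ` (given as a measure on the complexification), is a
Carleson measure for `H²(V + iΩ)`: the space embeds boundedly into `L²(dμ)`. -/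
def IsCarlesonMeasure (Ω : Set V) (μ : Measure (V × V)) : Prop :=
  ∃ C : ℝ, 0 < C ∧ ∀ F : V × V → ℂ, MemHardy Ω F →
    ∫⁻ z in tube Ω, ‖F z‖ₑ ^ 2 ∂μ ≤ ENNReal.ofReal C * hardyNorm Ω F ^ 2

/-- The measure `dμ(x + iy) = dx φ(y) dy` on the tube `V + iΩ`. -/
def radialMeasure (Ω : Set V) (φ : V → ℝ) : Measure (V × V) :=
  (volume : Measure V).prod ((volume.restrict Ω).withDensity fun y => ENNReal.ofReal (φ y))

end Tube

/-- There is a constant `C` with `∫_Ω Δ(y + t)^{-2α + n/r} φ(y) dy ≤ C Δ(t)^{-2α + n/r}` for all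
`t ∈ Ω`. -/
def EuclideanJordanAlgebra.DetBound {V : Type*} [NormedAddCommGroup V] [InnerProductSpace ℝ V]
    [FiniteDimensional ℝ V] [MeasurableSpace V] [BorelSpace V]
    (J : EuclideanJordanAlgebra V) (φ : V → ℝ) (α : ℝ) : Prop :=
  ∃ C : ℝ, 0 < C ∧ ∀ t ∈ J.cone,
    ∫⁻ y in J.cone,
        ENNReal.ofReal (J.det (y + t) ^ (-2 * α + (finrank ℝ V : ℝ) / J.rank) * φ y) ≤
      ENNReal.ofReal (C * J.det t ^ (-2 * α + (finrank ℝ V : ℝ) / J.rank))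

end

/-! Write `Δ` for the determinant, `e` for the identity and `Ω` for the cone. By Tonelli the
integral of `|F|²` against `dx φ(y) dy` is the `φ`-weighted integral over `Ω` of the squared slice
norms `∫ |F(x + iy)|² dx`, each at most `‖F‖²`; so integrability of `φ` gives the Carleson property.

Both returns to integrability use a family that becomes constant in `y` at infinity. For Carleson
measures, take linear coordinates `ξ i` nonnegative on `Ω` and test on `∏ᵢ (ξᵢ(z) + iR)⁻¹`. Divided
by the upper bound for the squared Hardy norm, its squared slice norms are `∏ᵢ R / (ξᵢ(y) + R)`,
which tend to `1` as `R → ∞`; Fatou bounds `∫ φ` by the Carleson constant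
(`lintegral_le_of_isCarlesonMeasure`). For `(*)`, put `t = R e`: homogeneity of `Δ` makes `Δ(y + R
e) / Δ(R e)` tend to `1`, and Fatou applies again (`lintegral_ne_top_of_detBound`).

Conversely, for admissible `α` the exponent in `(*)` is negative, so `(*)` follows from
integrability once `Δ(t) ≤ Δ(y + t)` is known (`detBound_of_integrableOn`).

The remaining work is to obtain from the definitions that `Δ` is a homogeneous polynomial, positive
and increasing on `Ω`, and that the squares form a self-dual cone. Each `x` is resolved into
orthogonal idempotents by diagonalising multiplication by `x`. A generic minimal polynomial shows
that regular elements are dense, so statements about `Δ` can be checked where it is the product of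
the eigenvalues. Monotonicity comes from an explicit derivative formula
(`IsResolution.hasDerivAt_det`). -/

noncomputable section

/-! ### Power associativity and the spectral resolution. -/

namespace EuclideanJordanAlgebra

variable {V : Type*} [NormedAddCommGroup V] [InnerProductSpace ℝ V]
variable (J : EuclideanJordanAlgebra V)

/-- The polarised Jordan identity. -/
theorem jordan_polarized (x y z : V) :
    J.mul (J.mul x x) (J.mul y z) + (2 : ℝ) • J.mul (J.mul x y) (J.mul x z) =
      J.mul y (J.mul (J.mul x x) z) + (2 : ℝ) • J.mul x (J.mul (J.mul x y) z) := by
  have h1 := J.jordan (x + y) z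
  have h2 := J.jordan (x - y) z
  have h3 := J.jordan y z
  simp only [map_add, map_sub, LinearMap.add_apply, LinearMap.sub_apply, J.mul_comm y x] at h1 h2
  linear_combination (norm := module) (1 / 2 : ℝ) • h1 - (1 / 2 : ℝ) • h2 - h3

/-- The polarised identity is linear in `y`; it is read here as an identity of operators acting on
`y`. With `z` a power of `x` it becomes a recursion for multiplication by powers. -/
theorem mul_sq_mul (x z : V) :
    J.mul (J.mul (J.mul x x) z) =
      J.mul (J.mul x x) * J.mul z +
        (2 : ℝ) • ((J.mul (J.mul x z) - J.mul x * J.mul z) * J.mul x) := by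
  ext y
  have h := J.jordan_polarized x y z
  simp only [J.mul_comm y, J.mul_comm (J.mul x y)] at h
  simp only [LinearMap.add_apply, LinearMap.smul_apply, LinearMap.sub_apply, Module.End.mul_apply]
  rw [J.mul_comm (J.mul x z) (J.mul x y), J.mul_comm (J.mul x y) (J.mul x z)]
  linear_combination (norm := module) -h

theorem pow_eq (x : V) (k : ℕ) : J.pow x k = (J.mul x ^ k) J.one := by
  induction k with
  | zero => rfl
  | succ k ih => rw [pow, ih, pow_succ', Module.End.mul_apply]

theorem mul_one' (x : V) : J.mul x J.one = x := by rw [J.mul_comm, J.one_mul]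

theorem mul_one_eq : J.mul J.one = 1 := LinearMap.ext J.one_mul

theorem commute_mul_sq (x : V) : Commute (J.mul x) (J.mul (J.mul x x)) :=
  LinearMap.ext fun y => (J.jordan x y).symm

theorem sq_mul_pow (x : V) (k : ℕ) : J.mul (J.mul x x) (J.pow x k) = J.pow x (k + 2) := by
  have h := LinearMap.congr_fun ((J.commute_mul_sq x).symm.pow_right k).eq J.one
  simp only [Module.End.mul_apply, J.mul_one'] at h
  rw [J.pow_eq, h, J.pow_eq, pow_add]
  simp [pow_two, J.mul_one']

/-- By `mul_sq_mul`, multiplication by `x ^ (k + 2)` is a polynomial expression in the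
multiplications by lower powers, all of which commute with that by `x`. Power associativity follows
by applying the commutation to `e`. -/
theorem commute_mul_pow (x : V) (k : ℕ) : Commute (J.mul x) (J.mul (J.pow x k)) := by
  induction k using Nat.strong_induction_on with
  | _ k ih =>
    match k with
    | 0 => rw [pow, J.mul_one_eq]; exact Commute.one_right _
    | 1 => rw [pow, pow, J.mul_one']
    | k + 2 =>
      rw [← J.sq_mul_pow, J.mul_sq_mul]
      refine ((J.commute_mul_sq x).mul_right (ih k (by omega))).add_right
        (Commute.smul_right (((ih (k + 1) (by omega)).sub_right
          ((Commute.refl _).mul_right (ih k (by omega)))).mul_right (Commute.refl _)) _)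

theorem pow_mul_pow (x : V) (j k : ℕ) : J.mul (J.pow x j) (J.pow x k) = J.pow x (j + k) := by
  have h := LinearMap.congr_fun ((J.commute_mul_pow x j).symm.pow_right k).eq J.one
  simp only [Module.End.mul_apply, J.mul_one'] at h
  rw [J.pow_eq x k, h, J.pow_eq x j, J.pow_eq, add_comm, pow_add, Module.End.mul_apply]

theorem evalAt_eq (x : V) (q : Polynomial ℝ) :
    J.evalAt x q = Polynomial.aeval (J.mul x) q J.one := by
  rw [evalAt, Polynomial.aeval_eq_sum_range, LinearMap.sum_apply,
    Polynomial.sum_over_range]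
  · simp [J.pow_eq]
  · simp

theorem evalAt_mul (x : V) (p q : Polynomial ℝ) :
    J.evalAt x (p * q) = J.mul (J.evalAt x p) (J.evalAt x q) := by
  have hm (j k : ℕ) (a b : ℝ) : J.evalAt x (Polynomial.monomial j a * Polynomial.monomial k b) =
      J.mul (J.evalAt x (Polynomial.monomial j a)) (J.evalAt x (Polynomial.monomial k b)) := by
    simp [evalAt, Polynomial.monomial_mul_monomial, Polynomial.sum_monomial_index, J.pow_mul_pow,
      smul_smul, _root_.mul_comm]
  have hadd (p q : Polynomial ℝ) : J.evalAt x (p + q) = J.evalAt x p + J.evalAt x q := by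
    simp [evalAt_eq]
  induction p using Polynomial.induction_on' with
  | add p₁ p₂ h₁ h₂ => rw [add_mul, hadd, hadd, h₁, h₂, map_add, LinearMap.add_apply]
  | monomial j a =>
    induction q using Polynomial.induction_on' with
    | add q₁ q₂ h₁ h₂ => rw [mul_add, hadd, hadd, h₁, h₂, map_add]
    | monomial k b => exact hm j k a b

theorem isSymmetric_mul (x : V) : (J.mul x).IsSymmetric := fun y z => J.inner_mul x y z

/-- `c` is the spectral resolution of the identity of the element `x`: the sum of the `c a` is the
identity, and `x (c a) = a (c a)`. -/
structure IsResolution (x : V) (c : ℝ →₀ V) : Prop where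
  mul_apply : ∀ a, J.mul x (c a) = a • c a
  sum_eq : ∑ a ∈ c.support, c a = J.one

/-- Multiplication by `x` is self-adjoint, hence diagonalisable; the `c a` are the components of `e`
in its eigenspaces. -/
theorem exists_isResolution [FiniteDimensional ℝ V] (x : V) : ∃ c, J.IsResolution x c := by
  have h := (J.isSymmetric_mul x).orthogonalComplement_iSup_eigenspaces_eq_bot
  rw [Submodule.orthogonal_eq_bot_iff] at h
  have h1 : J.one ∈ ⨆ μ, End.eigenspace (J.mul x) μ := h ▸ Submodule.mem_top
  obtain ⟨c, hc, hs⟩ := (Submodule.mem_iSup_iff_exists_finsupp _ _).1 h1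
  exact ⟨c, fun a => End.mem_eigenspace_iff.1 (hc a), hs⟩

end EuclideanJordanAlgebra

/-! ### Calculus with the spectral idempotents. -/

namespace EuclideanJordanAlgebra

theorem norm_sq_pos_of_mem_support {E : Type*} [NormedAddCommGroup E] {c : ℝ →₀ E} {a : ℝ}
    (ha : a ∈ c.support) : 0 < ‖c a‖ ^ 2 :=
  pow_pos (norm_pos_iff.2 (Finsupp.mem_support_iff.1 ha)) 2

variable {V : Type*} [NormedAddCommGroup V] [InnerProductSpace ℝ V]
variable {J : EuclideanJordanAlgebra V}

open Polynomial in
theorem aeval_apply_of_apply_eq_smul {A : V →ₗ[ℝ] V} {a : ℝ} {v : V} (h : A v = a • v)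
    (p : ℝ[X]) : aeval A p v = p.eval a • v := by
  induction p using Polynomial.induction_on' with
  | add p q hp hq => simp [hp, hq, add_smul]
  | monomial k b =>
    have hk : (A ^ k) v = a ^ k • v := by
      induction k with
      | zero => simp
      | succ k ih => rw [_root_.pow_succ, Module.End.mul_apply, h, map_smul, ih, smul_smul,
          _root_.mul_comm, ← _root_.pow_succ]
    simp [aeval_monomial, hk, smul_smul, _root_.mul_comm]

namespace IsResolution

variable {x : V} {c : ℝ →₀ V}

theorem inner_of_ne (hc : J.IsResolution x c) {a b : ℝ} (h : a ≠ b) :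
    inner ℝ (c a) (c b) = 0 := by
  have h1 := J.inner_mul x (c a) (c b)
  rw [hc.mul_apply, hc.mul_apply, real_inner_smul_left, real_inner_smul_right] at h1
  have h2 : (a - b) * inner ℝ (c a) (c b) = 0 := by linarith
  exact (mul_eq_zero.1 h2).resolve_left (sub_ne_zero.2 h)

theorem evalAt_eq_sum (hc : J.IsResolution x c) (p : Polynomial ℝ) :
    J.evalAt x p = ∑ a ∈ c.support, p.eval a • c a := by
  rw [J.evalAt_eq, ← hc.sum_eq, map_sum]
  exact Finset.sum_congr rfl fun a _ => aeval_apply_of_apply_eq_smul (hc.mul_apply a) p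

theorem eq_sum (hc : J.IsResolution x c) : x = ∑ a ∈ c.support, a • c a := by
  conv_lhs => rw [← J.mul_one' x, ← hc.sum_eq, map_sum]
  exact Finset.sum_congr rfl fun a _ => hc.mul_apply a

theorem inner_sum_smul (hc : J.IsResolution x c) (f : ℝ → ℝ) (b : ℝ) :
    inner ℝ (∑ a ∈ c.support, f a • c a) (c b) = f b * ‖c b‖ ^ 2 := by
  rw [sum_inner, Finset.sum_eq_single b]
  · rw [real_inner_smul_left, real_inner_self_eq_norm_sq]
  · intro a _ hab
    rw [real_inner_smul_left, hc.inner_of_ne hab, mul_zero]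
  · intro hb
    simp [Finsupp.notMem_support_iff.1 hb]

theorem inner_one (hc : J.IsResolution x c) (b : ℝ) : inner ℝ J.one (c b) = ‖c b‖ ^ 2 := by
  simpa [hc.sum_eq] using hc.inner_sum_smul (fun _ => 1) b

theorem inner_self (hc : J.IsResolution x c) (b : ℝ) : inner ℝ x (c b) = b * ‖c b‖ ^ 2 := by
  conv_lhs => rw [hc.eq_sum]
  exact hc.inner_sum_smul _ b

theorem evalAt_eq_zero_iff (hc : J.IsResolution x c) (p : Polynomial ℝ) :
    J.evalAt x p = 0 ↔ ∀ a ∈ c.support, p.eval a = 0 := by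
  rw [hc.evalAt_eq_sum]
  refine ⟨fun h a ha => ?_, fun h => Finset.sum_eq_zero fun a ha => by rw [h a ha, zero_smul]⟩
  have h1 := hc.inner_sum_smul (fun a => p.eval a) a
  rw [h, inner_zero_left, eq_comm, mul_eq_zero] at h1
  exact h1.resolve_right (by simpa using ha)

/-- Being polynomials in `x`, the components multiply like polynomials on the finite spectrum; this
makes them orthogonal idempotents. -/
theorem eq_evalAt (hc : J.IsResolution x c) {a : ℝ} (ha : a ∈ c.support) :
    c a = J.evalAt x (Lagrange.basis c.support id a) := by
  rw [hc.evalAt_eq_sum, Finset.sum_eq_single_of_mem a ha]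
  · have := Lagrange.eval_basis_self (s := c.support) (v := id) (Function.injective_id.injOn) ha
    simp only [id] at this
    rw [this, one_smul]
  · intro b hb hab
    have := Lagrange.eval_basis_of_ne (s := c.support) (v := id) hab.symm hb
    simp only [id] at this
    rw [this, zero_smul]

theorem mul_self (hc : J.IsResolution x c) (a : ℝ) : J.mul (c a) (c a) = c a := by
  by_cases ha : a ∈ c.support
  · conv_lhs => rw [hc.eq_evalAt ha, ← J.evalAt_mul, hc.evalAt_eq_sum]
    rw [Finset.sum_eq_single_of_mem a ha]
    · have := Lagrange.eval_basis_self (s := c.support) (v := id) (Function.injective_id.injOn) ha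
      simp only [id] at this
      rw [Polynomial.eval_mul, this, _root_.one_mul, one_smul]
    · intro b hb hab
      have := Lagrange.eval_basis_of_ne (s := c.support) (v := id) hab.symm hb
      simp only [id] at this
      rw [Polynomial.eval_mul, this, zero_mul, zero_smul]
  · simp [Finsupp.notMem_support_iff.1 ha]

theorem mul_of_ne (hc : J.IsResolution x c) {a b : ℝ} (hab : a ≠ b) : J.mul (c a) (c b) = 0 := by
  by_cases ha : a ∈ c.support
  · by_cases hb : b ∈ c.support
    · rw [hc.eq_evalAt ha, hc.eq_evalAt hb, ← J.evalAt_mul, hc.evalAt_eq_zero_iff]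
      intro d hd
      rw [Polynomial.eval_mul]
      rcases eq_or_ne a d with rfl | had
      · have := Lagrange.eval_basis_of_ne (s := c.support) (v := id) hab.symm hd
        simp only [id] at this
        rw [this, mul_zero]
      · have := Lagrange.eval_basis_of_ne (s := c.support) (v := id) had hd
        simp only [id] at this
        rw [this, zero_mul]
    · simp [Finsupp.notMem_support_iff.1 hb]
  · simp [Finsupp.notMem_support_iff.1 ha]

theorem sum_smul_mul (hc : J.IsResolution x c) (f : ℝ → ℝ) (b : ℝ) :
    J.mul (∑ a ∈ c.support, f a • c a) (c b) = f b • c b := by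
  rw [map_sum, LinearMap.sum_apply, Finset.sum_eq_single b]
  · rw [map_smul, LinearMap.smul_apply, hc.mul_self]
  · intro a _ hab
    rw [map_smul, LinearMap.smul_apply, hc.mul_of_ne hab, smul_zero]
  · intro hb
    simp [Finsupp.notMem_support_iff.1 hb]

theorem sum_smul_mul_self (hc : J.IsResolution x c) (f : ℝ → ℝ) :
    J.mul (∑ a ∈ c.support, f a • c a) (∑ a ∈ c.support, f a • c a) =
      ∑ a ∈ c.support, (f a * f a) • c a := by
  conv_lhs => rw [map_sum (J.mul _)]
  refine Finset.sum_congr rfl fun a _ => ?_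
  rw [map_smul, hc.sum_smul_mul, smul_smul]

open Polynomial in
theorem card_support_le (hc : J.IsResolution x c) {q : ℝ[X]} (hq : q.Monic)
    (h : J.evalAt x q = 0) : c.support.card ≤ q.natDegree :=
  Polynomial.card_le_degree_of_subset_roots fun a ha =>
    (mem_roots hq.ne_zero).2 ((hc.evalAt_eq_zero_iff q).1 h a ha)

open Polynomial in
theorem evalAt_prod (hc : J.IsResolution x c) :
    J.evalAt x (∏ a ∈ c.support, (X - C a)) = 0 :=
  (hc.evalAt_eq_zero_iff _).2 fun a ha => by
    rw [eval_prod, Finset.prod_eq_zero ha (by simp)]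

-- A polynomial annihilates `x` exactly when it vanishes on the spectrum, so the least degree counts
-- the distinct eigenvalues.
open Polynomial in
theorem degree_eq (hc : J.IsResolution x c) : J.degree x = c.support.card := by
  refine le_antisymm (Nat.sInf_le ⟨_, monic_prod_X_sub_C _ _, hc.evalAt_prod, by simp⟩) ?_
  refine le_csInf ⟨_, _, monic_prod_X_sub_C _ _, hc.evalAt_prod, rfl⟩ ?_
  rintro _ ⟨q, hq, h, rfl⟩
  exact hc.card_support_le hq h

open Polynomial in
theorem eq_prod (hc : J.IsResolution x c) {q : ℝ[X]} (hq : q.Monic)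
    (h : J.evalAt x q = 0) (hd : q.natDegree = c.support.card) :
    q = ∏ a ∈ c.support, (X - C a) := by
  refine eq_of_degree_le_of_eval_finset_eq c.support ?_ ?_ ?_ fun a ha => ?_
  · rw [Polynomial.degree_eq_natDegree hq.ne_zero, hd]
  · rw [Polynomial.degree_eq_natDegree hq.ne_zero, hd, degree_prod]
    simp
  · rw [hq.leadingCoeff, (monic_prod_X_sub_C _ _).leadingCoeff]
  · rw [(hc.evalAt_eq_zero_iff q).1 h a ha,
      (hc.evalAt_eq_zero_iff _).1 hc.evalAt_prod a ha]

theorem smul (hc : J.IsResolution x c) {R : ℝ} (hR : R ≠ 0) :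
    J.IsResolution (R • x) (Finsupp.equivMapDomain (Equiv.mulLeft₀ R hR) c) where
  mul_apply a := by
    rw [Finsupp.equivMapDomain_apply, map_smul, LinearMap.smul_apply, hc.mul_apply, smul_smul]
    congr 1
    simp [hR]
  sum_eq := by
    have h := Finsupp.sum_equivMapDomain (Equiv.mulLeft₀ R hR) c (fun _ v => v)
    simp only [Finsupp.sum] at h
    rw [h, hc.sum_eq]

end IsResolution

/-! ### Squares, self-duality and the symmetric cone. -/

/-- The set of squares of the algebra. -/
def squares (J : EuclideanJordanAlgebra V) : Set V := Set.range fun x => J.mul x x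

/-- Multiplication by an idempotent satisfies `2L³ - 3L² + L = 0`, so its eigenvalues lie in `{0,
1/2, 1}` (Peirce decomposition). -/
theorem inner_mul_nonneg_of_mul_self {c : V} (hc : J.mul c c = c) (z : V) :
    0 ≤ inner ℝ (J.mul c z) z := by
  have h0 (y : V) : (2 : ℝ) • J.mul c (J.mul c (J.mul c y)) =
      (3 : ℝ) • J.mul c (J.mul c y) - J.mul c y := by
    have h := LinearMap.congr_fun (J.mul_sq_mul c c) y
    simp only [hc, LinearMap.add_apply, LinearMap.smul_apply, LinearMap.sub_apply,
      Module.End.mul_apply] at h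
    linear_combination (norm := module) h
  have hs := J.inner_mul c
  set u := J.mul c z
  set v := J.mul c u
  set w := J.mul c v with hw
  have hz : (2 : ℝ) • w = (3 : ℝ) • v - u := h0 z
  have e1 : inner ℝ u u = inner ℝ v z := (hs u z).symm
  have e2 : inner ℝ v u = inner ℝ w z := (hs v z).symm
  have e3 : inner ℝ v v = inner ℝ w u := (hs v u).symm
  have f1 : 2 * inner ℝ w z = 3 * inner ℝ v z - inner ℝ u z := by
    rw [← real_inner_smul_left, hz, inner_sub_left, real_inner_smul_left]
  have f2 : 2 * inner ℝ w u = 3 * inner ℝ v u - inner ℝ u u := by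
    rw [← real_inner_smul_left, hz, inner_sub_left, real_inner_smul_left]
  -- On `{0, 1/2, 1}` one has `λ = λ²(2λ - 1)² + 8λ²(λ - 1)²`, whence `⟪u, z⟫ = ‖2v - u‖² + 8‖v -
  -- u‖²`.
  have g1 : 0 ≤ inner ℝ ((2 : ℝ) • v - u) ((2 : ℝ) • v - u) := real_inner_self_nonneg
  have g2 : 0 ≤ inner ℝ (v - u) (v - u) := real_inner_self_nonneg
  simp only [inner_sub_left, inner_sub_right, real_inner_smul_left, real_inner_smul_right,
    real_inner_comm v u] at g1 g2
  linarith

theorem inner_nonneg_of_mul_self {c x : V} (hc : J.mul c c = c) (hx : x ∈ J.squares) :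
    0 ≤ inner ℝ x c := by
  obtain ⟨z, rfl⟩ := hx
  have h := J.inner_mul_nonneg_of_mul_self hc z
  rw [J.mul_comm c z, J.inner_mul] at h
  rwa [real_inner_comm]

theorem isOpen_cone : IsOpen J.cone := isOpen_interior

theorem cone_subset_squares : J.cone ⊆ J.squares := interior_subset

theorem smul_mem_cone {x : V} (hx : x ∈ J.cone) {R : ℝ} (hR : 0 < R) : R • x ∈ J.cone := by
  have h : (fun z => R⁻¹ • z) ⁻¹' J.cone ⊆ J.squares := fun z hz => by
    obtain ⟨w, hw⟩ := cone_subset_squares hz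
    refine ⟨√R • w, ?_⟩
    simp only at hw ⊢
    rw [map_smul, map_smul, LinearMap.smul_apply, hw, smul_smul, smul_smul,
      Real.mul_self_sqrt hR.le, mul_inv_cancel₀ hR.ne', one_smul]
  refine interior_maximal h (isOpen_cone.preimage (by fun_prop)) ?_
  simpa [smul_smul, hR.ne'] using hx

theorem exists_sub_smul_mem_cone {x : V} (hx : x ∈ J.cone) (y : V) :
    ∃ ε : ℝ, 0 < ε ∧ x - ε • y ∈ J.cone := by
  have h : ∀ᶠ ε : ℝ in nhds 0, x - ε • y ∈ J.cone := by
    have : Filter.Tendsto (fun ε : ℝ => x - ε • y) (nhds 0) (nhds x) :=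
      Continuous.tendsto' (by fun_prop) _ _ (by simp)
    exact this.eventually (isOpen_cone.mem_nhds hx)
  obtain ⟨δ, hδ, h⟩ := Metric.eventually_nhds_iff.1 h
  exact ⟨δ / 2, by positivity, h (by simp [abs_of_pos hδ, hδ])⟩

/-- Since the cone is open, `x - ε e` is still a square for some `ε > 0`; pairing it with `c a`
gives `a ≥ ε`. -/
theorem IsResolution.pos {x : V} {c : ℝ →₀ V} (hc : J.IsResolution x c) (hx : x ∈ J.cone) {a : ℝ}
    (ha : a ∈ c.support) : 0 < a := by
  obtain ⟨ε, hε, h⟩ := exists_sub_smul_mem_cone hx J.one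
  have h1 := inner_nonneg_of_mul_self (hc.mul_self a) (cone_subset_squares h)
  rw [inner_sub_left, real_inner_smul_left, hc.inner_one, hc.inner_self, ← sub_mul] at h1
  have h2 : 0 ≤ a - ε := nonneg_of_mul_nonneg_left h1 (norm_sq_pos_of_mem_support ha)
  linarith

variable [FiniteDimensional ℝ V]

/-- One half of self-duality: testing against the idempotents `c a` makes the eigenvalues
nonnegative, and `∑ √a • c a` is then a square root. The description as a dual cone yields closure
under addition. -/
theorem mem_squares_of_inner_nonneg {x : V} (h : ∀ y ∈ J.squares, 0 ≤ inner ℝ x y) :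
    x ∈ J.squares := by
  obtain ⟨c, hc⟩ := J.exists_isResolution x
  have hnn : ∀ a ∈ c.support, 0 ≤ a := fun a ha => by
    have h1 := h (c a) ⟨c a, hc.mul_self a⟩
    rw [hc.inner_self] at h1
    exact nonneg_of_mul_nonneg_left h1 (norm_sq_pos_of_mem_support ha)
  refine ⟨∑ a ∈ c.support, √a • c a, ?_⟩
  simp only
  rw [hc.sum_smul_mul_self]
  conv_rhs => rw [hc.eq_sum]
  exact Finset.sum_congr rfl fun a ha => by rw [Real.mul_self_sqrt (hnn a ha)]

theorem inner_nonneg_of_mem_squares {x y : V} (hx : x ∈ J.squares) (hy : y ∈ J.squares) :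
    0 ≤ inner ℝ x y := by
  obtain ⟨c, hc⟩ := J.exists_isResolution x
  rw [hc.eq_sum, sum_inner]
  refine Finset.sum_nonneg fun a ha => ?_
  have h1 := inner_nonneg_of_mul_self (hc.mul_self a) hx
  rw [hc.inner_self] at h1
  have h2 : 0 ≤ a := nonneg_of_mul_nonneg_left h1 (norm_sq_pos_of_mem_support ha)
  rw [real_inner_smul_left, real_inner_comm]
  exact mul_nonneg h2 (inner_nonneg_of_mul_self (hc.mul_self a) hy)

theorem add_mem_squares {x y : V} (hx : x ∈ J.squares) (hy : y ∈ J.squares) :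
    x + y ∈ J.squares :=
  mem_squares_of_inner_nonneg fun z hz => by
    rw [inner_add_left]
    exact add_nonneg (inner_nonneg_of_mem_squares hx hz) (inner_nonneg_of_mem_squares hy hz)

theorem add_mem_cone {x y : V} (hx : x ∈ J.cone) (hy : y ∈ J.squares) : x + y ∈ J.cone := by
  have h : (fun z => z - y) ⁻¹' J.cone ⊆ J.squares := fun z hz => by
    simpa using add_mem_squares (cone_subset_squares hz) hy
  exact interior_maximal h (isOpen_cone.preimage (by fun_prop)) (by simpa using hx)

variable (J) in
/-- The elements close to the identity are squares. -/
theorem exists_ball_subset_squares : ∃ δ > 0, Metric.ball J.one δ ⊆ J.squares := by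
  obtain ⟨M, hM, h⟩ := (LinearMap.toContinuousLinearMap (LinearMap.toContinuousLinearMap.toLinearMap ∘ₗ J.mul)).bound
  -- Since `⟪x, z²⟫ = ‖z‖² + ⟪(x - e) z, z⟫` and `M` bounds the bilinear product, radius `M⁻¹` keeps
  -- this nonnegative.
  refine ⟨M⁻¹, inv_pos.2 hM, fun x hx => mem_squares_of_inner_nonneg ?_⟩
  rintro _ ⟨z, rfl⟩
  have h1 : ‖J.mul (x - J.one) z‖ ≤ M * ‖x - J.one‖ * ‖z‖ :=
    (ContinuousLinearMap.le_opNorm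
      (LinearMap.toContinuousLinearMap (J.mul (x - J.one))) z).trans
      (mul_le_mul_of_nonneg_right (h (x - J.one)) (norm_nonneg z))
  have h2 : M * ‖x - J.one‖ ≤ 1 := by
    rw [mem_ball_iff_norm] at hx
    calc M * ‖x - J.one‖ ≤ M * M⁻¹ := by gcongr
      _ = 1 := mul_inv_cancel₀ hM.ne'
  have h3 := abs_real_inner_le_norm (J.mul (x - J.one) z) z
  have h4 : inner ℝ x (J.mul z z) = ‖z‖ ^ 2 + inner ℝ (J.mul (x - J.one) z) z := by
    rw [map_sub, LinearMap.sub_apply, J.one_mul, inner_sub_left, real_inner_self_eq_norm_sq,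
      J.mul_comm x z, J.inner_mul]
    ring
  have h5 : ‖J.mul (x - J.one) z‖ * ‖z‖ ≤ ‖z‖ ^ 2 := by
    rw [pow_two]
    gcongr
    exact h1.trans (mul_le_of_le_one_left (norm_nonneg z) h2)
  have h6 := (abs_le.1 (h3.trans h5)).1
  simp only
  rw [h4]
  linarith

variable (J) in
theorem one_mem_cone : J.one ∈ J.cone := by
  obtain ⟨δ, hδ, h⟩ := J.exists_ball_subset_squares
  exact interior_maximal h Metric.isOpen_ball (Metric.mem_ball_self hδ)

end EuclideanJordanAlgebra

/-! ### Generic minimal polynomial of a vector under a matrix. -/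

section GenericMinpoly

open Polynomial

theorem Matrix.aeval_map_mulVec {R F ι : Type*} [CommRing R] [CommRing F] [Fintype ι]
    [DecidableEq ι] (f : R →+* F) (M : Matrix ι ι R) (v : ι → R) (p : R[X]) :
    (aeval (M.map f) (p.map f)).mulVec (f ∘ v) = f ∘ (aeval M p).mulVec v := by
  have h : (algebraMap F (Matrix ι ι F)).comp f =
      f.mapMatrix.comp (algebraMap R (Matrix ι ι R)) := by
    ext r j k
    simp [Matrix.algebraMap_matrix_apply, apply_ite f]
  have h1 : f.mapMatrix (aeval M p) = aeval (f.mapMatrix M) (p.map f) :=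
    Polynomial.map_aeval_eq_aeval_map h p M
  rw [RingHom.mapMatrix_apply, RingHom.mapMatrix_apply] at h1
  rw [← h1]
  ext j
  exact (RingHom.map_mulVec f _ _ j).symm

/-- The matrix whose columns are the vectors `v, M v, …, M ^ (d - 1) v`. -/
def Matrix.krylov {R ι : Type*} [CommRing R] [Fintype ι] [DecidableEq ι] (M : Matrix ι ι R)
    (v : ι → R) (d : ℕ) : Matrix ι (Fin d) R := fun j k => (M ^ (k : ℕ)).mulVec v j

theorem Matrix.krylov_map {R F ι : Type*} [CommRing R] [CommRing F] [Fintype ι]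
    [DecidableEq ι] (f : R →+* F) (M : Matrix ι ι R) (v : ι → R) (d : ℕ) :
    (M.krylov v d).map f = (M.map f).krylov (f ∘ v) d := by
  ext j k
  have h := congrFun (Matrix.aeval_map_mulVec f M v (X ^ (k : ℕ))) j
  simp only [Polynomial.map_pow, map_X, map_pow, aeval_X, Function.comp_apply] at h
  exact h.symm

theorem Matrix.krylov_mulVec {R ι : Type*} [CommRing R] [Fintype ι]
    [DecidableEq ι] (M : Matrix ι ι R) (v : ι → R) (d : ℕ) (a : Fin d → R) :
    (M.krylov v d).mulVec a = (aeval M (∑ k, C (a k) * X ^ (k : ℕ))).mulVec v := by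
  have h (k : Fin d) : aeval M (C (a k) * X ^ (k : ℕ)) = a k • M ^ (k : ℕ) := by
    rw [map_mul, aeval_C, map_pow, aeval_X, Algebra.smul_def]
  rw [map_sum, Matrix.sum_mulVec]
  ext j
  simp only [h, Matrix.smul_mulVec, Finset.sum_apply, Pi.smul_apply, smul_eq_mul]
  change ∑ k, M.krylov v d j k * a k = _
  exact Finset.sum_congr rfl fun k _ => mul_comm (M.krylov v d j k) (a k)

theorem Matrix.krylov_mulVec_coeff {R ι : Type*} [CommRing R] [Fintype ι]
    [DecidableEq ι] (M : Matrix ι ι R) (v : ι → R) {d : ℕ} {p : R[X]} (hp : p.natDegree < d) :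
    (M.krylov v d).mulVec (fun k => p.coeff k) = (aeval M p).mulVec v := by
  rw [Matrix.krylov_mulVec]
  congr 2
  rw [Fin.sum_univ_eq_sum_range (fun k => C (p.coeff k) * X ^ k) d]
  exact (p.as_sum_range_C_mul_X_pow' hp).symm

open Classical in
/-- Over an integrally closed domain, a vector has a generic minimal polynomial with respect to a
square matrix: a monic annihilating polynomial whose degree is minimal after every
specialisation outside a hypersurface. -/
theorem Matrix.exists_generic_minpoly {R ι : Type*} [CommRing R] [IsDomain R] [IsIntegrallyClosed R]
    [Fintype ι] [DecidableEq ι] (M : Matrix ι ι R) (v : ι → R) :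
    ∃ (g : R[X]) (q : R), g.Monic ∧ (aeval M g).mulVec v = 0 ∧ g.natDegree ≤ Fintype.card ι ∧
      q ≠ 0 ∧ ∀ (F : Type) [Field F] (f : R →+* F), f q ≠ 0 → ∀ p : F[X], p.Monic →
        (aeval (M.map f) p).mulVec (f ∘ v) = 0 → g.natDegree ≤ p.natDegree := by
  let K := FractionRing R
  let i : R →+* K := algebraMap R K
  have hi : Function.Injective i := IsFractionRing.injective R K
  let I : Ideal K[X] :=
    { carrier := {p | (aeval (M.map i) p).mulVec (i ∘ v) = 0}
      add_mem' := fun {a b} ha hb => by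
        simp only [Set.mem_ofPred_eq] at ha hb ⊢
        rw [map_add, Matrix.add_mulVec, ha, hb, add_zero]
      zero_mem' := by simp
      smul_mem' := fun a b hb => by
        simp only [Set.mem_ofPred_eq] at hb ⊢
        rw [smul_eq_mul, map_mul, ← Matrix.mulVec_mulVec, hb, Matrix.mulVec_zero] }
  have hI (p : K[X]) : p ∈ I ↔ (aeval (M.map i) p).mulVec (i ∘ v) = 0 := Iff.rfl
  have hchar : M.charpoly.map i ∈ I := by
    rw [hI, Matrix.aeval_map_mulVec, Matrix.aeval_self_charpoly]
    ext j
    simp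
  have hchar0 : M.charpoly.map i ≠ 0 := ((Matrix.charpoly_monic M).map i).ne_zero
  let g0 : K[X] := normalize (Submodule.IsPrincipal.generator I)
  have hdvd (p : K[X]) : p ∈ I ↔ g0 ∣ p := by
    rw [normalize_dvd_iff]
    exact Submodule.IsPrincipal.mem_iff_generator_dvd I
  have hg0 : g0.Monic := by
    refine Polynomial.monic_normalize fun h => hchar0 ?_
    have := (Submodule.IsPrincipal.mem_iff_generator_dvd I).1 hchar
    rwa [h, zero_dvd_iff] at this
  -- Gauss's lemma: the monic generator of the annihilator over the fraction field divides the
  -- characteristic polynomial, so its coefficients lie in `R`.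
  obtain ⟨g, hg⟩ := IsIntegrallyClosed.eq_map_mul_C_of_dvd K (Matrix.charpoly_monic M)
    ((hdvd _).1 hchar)
  rw [hg0.leadingCoeff, C_1, mul_one] at hg
  have hgm : g.Monic := Polynomial.monic_of_injective hi (hg.symm ▸ hg0)
  have hgd : g0.natDegree = g.natDegree := by rw [← hg]; exact natDegree_map_eq_of_injective hi g
  -- A kernel vector is an annihilating polynomial of degree below that of the generator, hence
  -- zero.
  have hinj : Function.Injective ((M.krylov v g.natDegree).map i).mulVecLin := by
    rw [← LinearMap.ker_eq_bot, LinearMap.ker_eq_bot']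
    intro a ha
    rw [Matrix.mulVecLin_apply, Matrix.krylov_map, Matrix.krylov_mulVec, ← hI, hdvd] at ha
    have hlt : (∑ k, C (a k) * X ^ (k : ℕ)).degree < g0.degree := by
      rw [degree_eq_natDegree hg0.ne_zero, hgd]
      exact Polynomial.degree_sum_fin_lt a
    have h0 := Polynomial.eq_zero_of_dvd_of_degree_lt ha hlt
    ext k
    have h1 := congrArg (fun p => p.coeff (k : ℕ)) h0
    simpa [Polynomial.finsetSum_coeff, coeff_C_mul, coeff_X_pow, Fin.val_inj] using h1
  obtain ⟨G, hG⟩ := LinearMap.exists_leftInverse_of_injective _ (LinearMap.ker_eq_bot.2 hinj)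
  have hG' : LinearMap.toMatrix' G * (M.krylov v g.natDegree).map i = 1 := by
    have := congrArg LinearMap.toMatrix' hG
    rwa [LinearMap.toMatrix'_comp, LinearMap.toMatrix'_id, ← Matrix.toLin'_apply',
      LinearMap.toMatrix'_toLin'] at this
  -- `q` is a common denominator of a left inverse of the Krylov matrix. Wherever `f q ≠ 0`, the
  -- specialised Krylov vectors therefore stay independent, excluding a monic annihilator of smaller
  -- degree.
  obtain ⟨⟨q, hq⟩, hint⟩ := IsLocalization.exist_integer_multiples_of_finite (nonZeroDivisors R)
    (fun x : Fin g.natDegree × ι => LinearMap.toMatrix' G x.1 x.2)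
  choose B hB using hint
  have hBK : (Matrix.of fun k j => B (k, j)) * M.krylov v g.natDegree =
      q • (1 : Matrix (Fin g.natDegree) (Fin g.natDegree) R) := by
    apply Matrix.map_injective hi
    have h1 : (Matrix.of fun k j => B (k, j)).map i = i q • LinearMap.toMatrix' G := by
      ext k j
      have := hB (k, j)
      simpa [Algebra.smul_def] using this
    simp only [Matrix.map_mul]
    rw [h1, Matrix.smul_mul, hG']
    ext k j
    simp [Matrix.one_apply, apply_ite i]
  refine ⟨g, q, hgm, ?_, ?_, nonZeroDivisors.ne_zero hq, ?_⟩
  · have h1 := (hdvd g0).2 dvd_rfl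
    rw [hI, ← hg, Matrix.aeval_map_mulVec] at h1
    ext j
    exact hi (by simpa using congrFun h1 j)
  · rw [← Matrix.charpoly_natDegree_eq_dim M, ← hgd]
    exact (natDegree_le_of_dvd ((hdvd _).1 hchar) hchar0).trans natDegree_map_le
  · intro F _ f hfq p hp h
    by_contra! hlt
    rw [← Matrix.krylov_mulVec_coeff _ _ hlt, ← Matrix.krylov_map] at h
    have h1 := congrArg (fun A => A.map f) hBK
    simp only [Matrix.map_mul] at h1
    have h2 := congrArg (fun A => A.mulVec (fun k : Fin g.natDegree => p.coeff k)) h1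
    simp only [← Matrix.mulVec_mulVec, h, Matrix.mulVec_zero] at h2
    have h3 : (q • (1 : Matrix (Fin g.natDegree) (Fin g.natDegree) R)).map f = f q • 1 := by
      ext k j
      simp [Matrix.one_apply, apply_ite f]
    rw [h3, Matrix.smul_mulVec, Matrix.one_mulVec] at h2
    have h4 := congrFun h2 ⟨p.natDegree, hlt⟩
    simp only [Pi.zero_apply, Pi.smul_apply, hp.coeff_natDegree, smul_eq_mul, mul_one] at h4
    exact hfq h4.symm

end GenericMinpoly

/-! ### Density of regular elements and the determinant. -/

namespace EuclideanJordanAlgebra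

variable {V : Type*} [NormedAddCommGroup V] [InnerProductSpace ℝ V] [FiniteDimensional ℝ V]

/-- Evaluation of polynomials at the coordinates of a vector. -/
def coordEval (x : V) : MvPolynomial (Fin (finrank ℝ V)) ℝ →+* ℝ :=
  MvPolynomial.eval fun i => (stdOrthonormalBasis ℝ V).repr x i

theorem analyticOnNhd_coordEval (p : MvPolynomial (Fin (finrank ℝ V)) ℝ) :
    AnalyticOnNhd ℝ (fun x : V => coordEval x p) Set.univ :=
  AnalyticOnNhd.eval_linearMap'
    (fun i => ((stdOrthonormalBasis ℝ V).toBasis.coord i : V →ₗ[ℝ] ℝ)) p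

theorem contDiff_coordEval (p : MvPolynomial (Fin (finrank ℝ V)) ℝ) :
    ContDiff ℝ 1 (fun x : V => coordEval x p) :=
  (analyticOnNhd_coordEval p).contDiff

/-- By the identity theorem for analytic functions, a polynomial vanishing near one point vanishes
everywhere. -/
theorem dense_coordEval_ne_zero {p : MvPolynomial (Fin (finrank ℝ V)) ℝ} (hp : p ≠ 0) :
    Dense {x : V | coordEval x p ≠ 0} := by
  intro x
  by_contra hx
  refine hp (MvPolynomial.funext fun y => ?_)
  have h1 : (fun x : V => coordEval x p) =ᶠ[nhds x] 0 := by
    rw [mem_closure_iff_frequently, Filter.not_frequently] at hx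
    filter_upwards [hx] with z hz
    simpa using hz
  have h2 := (analyticOnNhd_coordEval p).eq_of_eventuallyEq (fun _ _ => analyticAt_const) h1
  have h3 : coordEval _ p = 0 := congrFun h2 ((stdOrthonormalBasis ℝ V).repr.symm (WithLp.toLp 2 y))
  simpa [coordEval] using h3

variable (J : EuclideanJordanAlgebra V)

/-- The matrix of the multiplication by the generic element. -/
def genericMatrix : Matrix (Fin (finrank ℝ V)) (Fin (finrank ℝ V))
    (MvPolynomial (Fin (finrank ℝ V)) ℝ) :=
  ∑ k, (MvPolynomial.X k : MvPolynomial (Fin (finrank ℝ V)) ℝ) •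
    (LinearMap.toMatrixAlgEquiv (stdOrthonormalBasis ℝ V).toBasis
      (J.mul (stdOrthonormalBasis ℝ V k))).map MvPolynomial.C

theorem genericMatrix_map (x : V) : J.genericMatrix.map (coordEval x) =
    LinearMap.toMatrixAlgEquiv (stdOrthonormalBasis ℝ V).toBasis (J.mul x) := by
  conv_rhs => rw [← (stdOrthonormalBasis ℝ V).sum_repr x]
  ext i j
  simp [genericMatrix, Matrix.sum_apply, coordEval]

theorem aeval_genericMatrix_map (x : V) (p : Polynomial ℝ) :
    (Polynomial.aeval (J.genericMatrix.map (coordEval x)) p).mulVec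
      ((stdOrthonormalBasis ℝ V).toBasis.repr J.one) =
    (stdOrthonormalBasis ℝ V).toBasis.repr (J.evalAt x p) := by
  rw [J.genericMatrix_map, Polynomial.aeval_algHom_apply, J.evalAt_eq]
  exact LinearMap.toMatrix_mulVec_repr _ _ _ _

theorem exists_generic_minpoly :
    ∃ (g : Polynomial (MvPolynomial (Fin (finrank ℝ V)) ℝ))
      (q : MvPolynomial (Fin (finrank ℝ V)) ℝ), g.Monic ∧ g.natDegree ≤ finrank ℝ V ∧ q ≠ 0 ∧
      (∀ x, J.evalAt x (g.map (coordEval x)) = 0) ∧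
      ∀ x, coordEval x q ≠ 0 → ∀ p : Polynomial ℝ, p.Monic → J.evalAt x p = 0 →
        g.natDegree ≤ p.natDegree := by
  let b := (stdOrthonormalBasis ℝ V).toBasis
  obtain ⟨g, q, hg, h0, hd, hq, hmin⟩ := Matrix.exists_generic_minpoly J.genericMatrix
    (fun i => MvPolynomial.C (b.repr J.one i))
  have hv (x : V) : coordEval x ∘ (fun i => MvPolynomial.C (b.repr J.one i)) = b.repr J.one := by
    ext i
    simp [coordEval]
  refine ⟨g, q, hg, by simpa using hd, hq, fun x => ?_, fun x hx p hp h => ?_⟩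
  · have h1 := J.aeval_genericMatrix_map x (g.map (coordEval x))
    rw [← hv x, Matrix.aeval_map_mulVec, h0] at h1
    refine b.repr.injective (DFunLike.coe_injective ?_)
    rw [← h1]
    ext i
    simp
  · refine hmin ℝ (coordEval x) hx p hp ?_
    rw [hv, J.aeval_genericMatrix_map, h]
    simp

/-- The generic minimal polynomial of the algebra. -/
def genMinpoly : Polynomial (MvPolynomial (Fin (finrank ℝ V)) ℝ) := J.exists_generic_minpoly.choose

theorem genMinpoly_monic : J.genMinpoly.Monic := J.exists_generic_minpoly.choose_spec.choose_spec.1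

theorem genMinpoly_natDegree_le : J.genMinpoly.natDegree ≤ finrank ℝ V :=
  J.exists_generic_minpoly.choose_spec.choose_spec.2.1

theorem evalAt_genMinpoly (x : V) : J.evalAt x (J.genMinpoly.map (coordEval x)) = 0 :=
  J.exists_generic_minpoly.choose_spec.choose_spec.2.2.2.1 x

theorem degree_le (x : V) : J.degree x ≤ J.genMinpoly.natDegree :=
  Nat.sInf_le ⟨_, J.genMinpoly_monic.map _, J.evalAt_genMinpoly x,
    J.genMinpoly_monic.natDegree_map _⟩

theorem dense_degree_eq : Dense {x | J.degree x = J.genMinpoly.natDegree} := by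
  obtain ⟨-, -, hq, -, hmin⟩ := J.exists_generic_minpoly.choose_spec.choose_spec
  refine (dense_coordEval_ne_zero hq).mono fun x hx => (J.degree_le x).antisymm ?_
  refine le_csInf ⟨_, _, J.genMinpoly_monic.map _, J.evalAt_genMinpoly x, rfl⟩ ?_
  rintro _ ⟨p, hp, h, rfl⟩
  exact hmin x hx p hp h

theorem rank_eq : J.rank = J.genMinpoly.natDegree := by
  obtain ⟨x, hx⟩ := J.dense_degree_eq.nonempty
  exact le_antisymm (csSup_le (Set.range_nonempty _) (by rintro _ ⟨x, rfl⟩; exact J.degree_le x))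
    (le_csSup ⟨_, by rintro _ ⟨x, rfl⟩; exact J.degree_le x⟩ ⟨x, hx⟩)

theorem dense_isRegular : Dense {x | J.IsRegular x} := by
  simpa only [IsRegular, J.rank_eq] using J.dense_degree_eq

theorem rank_le_finrank : J.rank ≤ finrank ℝ V := J.rank_eq.trans_le J.genMinpoly_natDegree_le

theorem rank_pos [Nontrivial V] : 0 < J.rank := by
  obtain ⟨x, hx⟩ := J.dense_isRegular.nonempty
  obtain ⟨c, hc⟩ := J.exists_isResolution x
  rw [← show J.degree x = J.rank from hx, hc.degree_eq, Finset.card_pos, Finset.nonempty_iff_ne_empty]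
  intro h
  have h1 := hc.sum_eq
  rw [h, Finset.sum_empty] at h1
  obtain ⟨y, hy⟩ := exists_ne (0 : V)
  exact hy (by rw [← J.one_mul y, ← h1]; simp)

variable {J} in
theorem IsResolution.genMinpoly_map_eq {x : V} {c : ℝ →₀ V} (hc : J.IsResolution x c)
    (hx : J.IsRegular x) : J.genMinpoly.map (coordEval x) =
      ∏ a ∈ c.support, (Polynomial.X - Polynomial.C a) :=
  hc.eq_prod (J.genMinpoly_monic.map _) (J.evalAt_genMinpoly x) (by
    rw [J.genMinpoly_monic.natDegree_map, ← J.rank_eq, ← hc.degree_eq]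
    exact hx.symm)

theorem isDeterminant_genMinpoly :
    J.IsDeterminant fun x => (-1) ^ J.rank * coordEval x (J.genMinpoly.coeff 0) := by
  refine ⟨⟨(-1) ^ J.rank * J.genMinpoly.coeff 0, fun x => ?_⟩, fun x hx q hq => ?_⟩
  · simp [coordEval]
  · obtain ⟨c, hc⟩ := J.exists_isResolution x
    have hd : q.natDegree = c.support.card :=
      le_antisymm ((hq.2.2 _ (Polynomial.monic_prod_X_sub_C _ _) hc.evalAt_prod).trans_eq (by simp))
        (hc.card_support_le hq.1 hq.2.1)
    rw [hc.eq_prod hq.1 hq.2.1 hd, ← hc.genMinpoly_map_eq hx, Polynomial.coeff_map]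

theorem det_isDeterminant : J.IsDeterminant J.det := by
  have h : ∃ D, J.IsDeterminant D := ⟨_, J.isDeterminant_genMinpoly⟩
  rw [det, dif_pos h]
  exact h.choose_spec

theorem exists_isMinpoly (x : V) : ∃ q, J.IsMinpoly x q := by
  obtain ⟨c, hc⟩ := J.exists_isResolution x
  exact ⟨_, Polynomial.monic_prod_X_sub_C _ _, hc.evalAt_prod, fun p hp h => by
    simpa using hc.card_support_le hp h⟩

/-- Two continuous functions agreeing on the dense set of regular elements coincide; this frees
`det` from the choice in its definition. -/
theorem det_eq : J.det = fun x => (-1) ^ J.rank * coordEval x (J.genMinpoly.coeff 0) := by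
  obtain ⟨⟨P, hP⟩, h⟩ := J.det_isDeterminant
  refine Continuous.ext_on J.dense_isRegular ?_ ?_ fun x hx => ?_
  · rw [show J.det = fun x => coordEval x P from funext hP]
    exact (contDiff_coordEval P).continuous
  · exact continuous_const.mul (contDiff_coordEval _).continuous
  · obtain ⟨q, hq⟩ := J.exists_isMinpoly x
    exact (h x hx q hq).trans (J.isDeterminant_genMinpoly.2 x hx q hq).symm

theorem contDiff_det : ContDiff ℝ 1 J.det := by
  rw [det_eq]
  exact contDiff_const.mul (contDiff_coordEval _)

variable {J} in
theorem IsResolution.det_eq {x : V} {c : ℝ →₀ V} (hc : J.IsResolution x c)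
    (hx : J.IsRegular x) : J.det x = ∏ a ∈ c.support, a := by
  have hr : J.rank = c.support.card := by rw [← hc.degree_eq]; exact hx.symm
  rw [J.det_eq]
  simp only
  rw [← Polynomial.coeff_map, hc.genMinpoly_map_eq hx, Polynomial.coeff_zero_eq_eval_zero,
    Polynomial.eval_prod, hr, ← Finset.prod_const, ← Finset.prod_mul_distrib]
  simp

/-- Scaling multiplies the eigenvalues by `R` and keeps them distinct, so the formula holds at
regular elements and extends by density. -/
theorem det_smul (x : V) (R : ℝ) (hR : R ≠ 0) : J.det (R • x) = R ^ J.rank * J.det x := by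
  have h : (fun x => J.det (R • x)) = fun x => R ^ J.rank * J.det x := by
    refine Continuous.ext_on J.dense_isRegular
      (J.contDiff_det.continuous.comp (continuous_const_smul R))
      (continuous_const.mul J.contDiff_det.continuous) fun x hx => ?_
    obtain ⟨c, hc⟩ := J.exists_isResolution x
    have hr : J.rank = c.support.card := by rw [← hc.degree_eq]; exact hx.symm
    have hx' : J.IsRegular (R • x) := by
      rw [IsRegular, (hc.smul hR).degree_eq, hr]
      simp [Finsupp.equivMapDomain]
    rw [hc.det_eq hx, (hc.smul hR).det_eq hx', hr, ← Finset.prod_const, ← Finset.prod_mul_distrib]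
    simp [Finsupp.equivMapDomain]
  exact congrFun h x

end EuclideanJordanAlgebra

/-! ### Derivative, monotonicity and positivity of the determinant. -/

namespace EuclideanJordanAlgebra

variable {V : Type*} [NormedAddCommGroup V] [InnerProductSpace ℝ V]
variable {J : EuclideanJordanAlgebra V}

theorem evalAt_eq_sum_range (x : V) (p : Polynomial ℝ) :
    J.evalAt x p = ∑ k ∈ Finset.range (p.natDegree + 1), p.coeff k • J.pow x k := by
  rw [evalAt, Polynomial.sum_over_range]
  simp

namespace IsResolution

variable {x : V} {c : ℝ →₀ V}

theorem inner_pow (hc : J.IsResolution x c) (k : ℕ) (u : V) (a : ℝ) :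
    inner ℝ (J.mul u (J.pow x k)) (c a) = a ^ k * inner ℝ u (c a) := by
  have h : J.pow x k = ∑ b ∈ c.support, b ^ k • c b := by
    have := hc.evalAt_eq_sum (Polynomial.X ^ k)
    simpa [evalAt, Polynomial.X_pow_eq_monomial, Polynomial.sum_monomial_index] using this
  rw [J.mul_comm, J.inner_mul, h, hc.sum_smul_mul, real_inner_smul_right]

/-- After pairing with `c a`, associativity of the inner product moves each factor `x` onto `c a`,
where it acts as `a`; the derivative then looks as if `x` and `u` were scalars. -/
theorem hasDerivAt_pow [FiniteDimensional ℝ V] (hc : J.IsResolution x c) (u : V) (k : ℕ) :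
    ∃ w, HasDerivAt (fun s : ℝ => J.pow (x + s • u) k) w 0 ∧
      ∀ a, inner ℝ w (c a) = k * a ^ (k - 1) * inner ℝ u (c a) := by
  induction k with
  | zero => exact ⟨0, hasDerivAt_const _ _, by simp⟩
  | succ k ih =>
    obtain ⟨w, hw, hi⟩ := ih
    let B : V →L[ℝ] V →L[ℝ] V := LinearMap.toContinuousLinearMap
      (LinearMap.toContinuousLinearMap.toLinearMap ∘ₗ J.mul)
    have hl : HasDerivAt (fun s : ℝ => x + s • u) u 0 := by
      simpa using ((hasDerivAt_id (0 : ℝ)).smul_const u).const_add x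
    have h : HasDerivAt (fun s : ℝ => B (x + s • u) (J.pow (x + s • u) k))
        (B u (J.pow x k) + B x w) 0 := by
      have h1 := B.hasFDerivAt.comp_hasDerivAt (0 : ℝ) hl
      simpa [add_comm] using h1.clm_apply hw
    refine ⟨_, h, fun a => ?_⟩
    change inner ℝ (J.mul u (J.pow x k) + J.mul x w) (c a) = _
    rw [inner_add_left, hc.inner_pow, J.inner_mul, hc.mul_apply, real_inner_smul_right, hi]
    rcases k with _ | k
    · simp
    · push_cast
      ring

end IsResolution

variable [FiniteDimensional ℝ V]

/-- The derivative of the determinant at a regular element. -/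
theorem IsResolution.hasDerivAt_det {x : V} {c : ℝ →₀ V} (hc : J.IsResolution x c)
    (hx : J.IsRegular x) (u : V) :
    HasDerivAt (fun s : ℝ => J.det (x + s • u))
      (∑ a ∈ c.support, inner ℝ u (c a) / ‖c a‖ ^ 2 * ∏ b ∈ c.support.erase a, b) 0 := by
  set g := J.genMinpoly with hg
  set d := g.natDegree with hd
  have hcard : d = c.support.card := by
    rw [← hc.degree_eq, hd, ← J.rank_eq]; exact hx.symm
  have hdiff (k : ℕ) : ∃ β, HasDerivAt (fun s : ℝ => coordEval (x + s • u) (g.coeff k)) β 0 := by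
    have h1 : Differentiable ℝ (fun s : ℝ => coordEval (x + s • u) (g.coeff k)) :=
      ((contDiff_coordEval (g.coeff k)).differentiable one_ne_zero).comp (by fun_prop)
    exact ⟨_, (h1 0).hasDerivAt⟩
  choose β hβ using hdiff
  -- The leading coefficient is constantly `1`, so `q`, the derivative of the generic minimal
  -- polynomial's coefficients, has degree below `d`.
  have hβd : β d = 0 := by
    refine (hβ d).unique ?_
    have h1 : g.coeff d = 1 := J.genMinpoly_monic.coeff_natDegree
    simpa only [h1, map_one] using hasDerivAt_const (0 : ℝ) (1 : ℝ)
  choose w hw hwi using hc.hasDerivAt_pow u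
  let G : Polynomial ℝ := g.map (coordEval x)
  have hG : G = Lagrange.nodal c.support id := hc.genMinpoly_map_eq hx
  let q : Polynomial ℝ := ∑ k ∈ Finset.range d, Polynomial.monomial k (β k)
  have hqe (a : ℝ) : q.eval a = ∑ k ∈ Finset.range (d + 1), β k * a ^ k := by
    rw [Finset.sum_range_succ, hβd, zero_mul, add_zero, Polynomial.eval_finsetSum]
    simp
  have hGe (a : ℝ) : G.derivative.eval a =
      ∑ k ∈ Finset.range (d + 1), G.coeff k * (k * a ^ (k - 1)) := by
    rw [Polynomial.derivative_eval, Polynomial.sum_over_range' _ (by simp) (d + 1)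
      (by rw [J.genMinpoly_monic.natDegree_map]; exact Nat.lt_succ_self _)]
    simp [mul_assoc]
  -- Differentiate the identity saying that the generic minimal polynomial at `x + s u` annihilates
  -- `x + s u`, after pairing it with `c a`.
  have hkey (a : ℝ) : q.eval a * ‖c a‖ ^ 2 + G.derivative.eval a * inner ℝ u (c a) = 0 := by
    have h1 : HasDerivAt (fun s : ℝ => ∑ k ∈ Finset.range (d + 1),
        coordEval (x + s • u) (g.coeff k) * inner ℝ (J.pow (x + s • u) k) (c a))
        (∑ k ∈ Finset.range (d + 1), (β k * inner ℝ (J.pow x k) (c a) +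
          coordEval x (g.coeff k) * inner ℝ (w k) (c a))) 0 := by
      refine HasDerivAt.fun_sum fun k _ => ?_
      have h2 := (hβ k).mul ((hw k).inner ℝ (hasDerivAt_const (0 : ℝ) (c a)))
      exact h2.congr_deriv (by simp)
    have h2 : (fun s : ℝ => ∑ k ∈ Finset.range (d + 1),
        coordEval (x + s • u) (g.coeff k) * inner ℝ (J.pow (x + s • u) k) (c a)) = fun _ => 0 := by
      ext s
      have h3 := J.evalAt_genMinpoly (x + s • u)
      rw [evalAt_eq_sum_range, J.genMinpoly_monic.natDegree_map] at h3
      have h4 := congrArg (fun v => inner ℝ v (c a)) h3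
      simpa [sum_inner, real_inner_smul_left] using h4
    rw [h2] at h1
    rw [← h1.unique (hasDerivAt_const (0 : ℝ) (0 : ℝ)), hqe, hGe, Finset.sum_mul, Finset.sum_mul,
      ← Finset.sum_add_distrib]
    refine Finset.sum_congr rfl fun k _ => ?_
    have h5 := hc.inner_pow k J.one a
    rw [J.one_mul, hc.inner_one] at h5
    rw [h5, hwi, Polynomial.coeff_map]
    ring
  -- The previous identity fixes `q` at `d` nodes, and `P` is its Lagrange interpolant. Its value at
  -- `0` gives the derivative of the constant coefficient.
  let P : Polynomial ℝ := -∑ a ∈ c.support,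
    Polynomial.C (inner ℝ u (c a) / ‖c a‖ ^ 2) * Lagrange.nodal (c.support.erase a) id
  have hqP : q = P := by
    refine Polynomial.eq_of_degrees_lt_of_eval_finset_eq c.support ?_ ?_ fun a ha => ?_
    · rw [← hcard]
      refine (Polynomial.degree_sum_le _ _).trans_lt ((Finset.sup_lt_iff (by simp)).2 fun k hk => ?_)
      exact (Polynomial.degree_monomial_le _ _).trans_lt (by exact_mod_cast Finset.mem_range.1 hk)
    · rw [Polynomial.degree_neg]
      refine (Polynomial.degree_sum_le _ _).trans_lt ((Finset.sup_lt_iff (by simp)).2 fun a ha => ?_)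
      rw [Polynomial.C_mul']
      refine (Polynomial.degree_smul_le _ _).trans_lt ?_
      rw [Lagrange.degree_nodal]
      exact_mod_cast Finset.card_erase_lt_of_mem ha
    · have h1 := hkey a
      have h2 := Lagrange.eval_nodal_derivative_eval_node_eq (v := (id : ℝ → ℝ)) ha
      simp only [id] at h2
      rw [hG, h2] at h1
      have h3 : P.eval a = -(inner ℝ u (c a) / ‖c a‖ ^ 2 *
          (Lagrange.nodal (c.support.erase a) id).eval a) := by
        simp only [P, Polynomial.eval_neg, Polynomial.eval_finsetSum, Polynomial.eval_mul,
          Polynomial.eval_C]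
        rw [Finset.sum_eq_single_of_mem a ha]
        intro b _ hb
        have := Lagrange.eval_nodal_at_node (v := (id : ℝ → ℝ))
          (Finset.mem_erase.2 ⟨hb.symm, ha⟩)
        simp only [id] at this
        rw [this, mul_zero]
      have h4 := (norm_sq_pos_of_mem_support ha).ne'
      rw [h3]
      refine mul_right_cancel₀ h4 ?_
      linear_combination h1 + (Lagrange.nodal (c.support.erase a) id).eval a *
        div_mul_cancel₀ (inner ℝ u (c a)) h4
  have hβ0 : β 0 = P.eval 0 := by
    rw [← hqP, hqe, Finset.sum_eq_single_of_mem 0 (by simp)]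
    · simp
    · intro k _ hk
      simp [hk]
  rw [J.det_eq]
  refine ((hβ 0).const_mul ((-1) ^ J.rank)).congr_deriv ?_
  rw [hβ0, J.rank_eq, ← hg, ← hd, hcard]
  simp only [P, Polynomial.eval_neg, Polynomial.eval_finsetSum, Polynomial.eval_mul,
    Polynomial.eval_C, Lagrange.eval_nodal, id, zero_sub]
  rw [mul_neg, Finset.mul_sum, ← Finset.sum_neg_distrib]
  refine Finset.sum_congr rfl fun a ha => ?_
  rw [← Finset.card_erase_add_one ha, pow_succ]
  have h1 : ((-1 : ℝ) ^ (c.support.erase a).card) * (-1) ^ (c.support.erase a).card = 1 := by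
    rw [← mul_pow]; simp
  have h2 : ∏ b ∈ c.support.erase a, -b =
      (-1) ^ (c.support.erase a).card * ∏ b ∈ c.support.erase a, b := by
    rw [← Finset.prod_const, ← Finset.prod_mul_distrib]
    simp
  rw [h2]
  linear_combination (inner ℝ u (c a) / ‖c a‖ ^ 2 * ∏ b ∈ c.support.erase a, b) * h1

/-- At regular points of the cone every term of the derivative formula is nonnegative; continuity of
the derivative and density give the rest. -/
theorem fderiv_det_nonneg {x u : V} (hx : x ∈ J.cone) (hu : u ∈ J.squares) :
    0 ≤ fderiv ℝ J.det x u := by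
  have hcl : IsClosed {x | 0 ≤ fderiv ℝ J.det x u} :=
    isClosed_le continuous_const ((J.contDiff_det.continuous_fderiv one_ne_zero).clm_apply continuous_const)
  have hsub : J.cone ∩ {x | J.IsRegular x} ⊆ {x | 0 ≤ fderiv ℝ J.det x u} := by
    rintro x ⟨hx, hr⟩
    obtain ⟨c, hc⟩ := J.exists_isResolution x
    have h1 := hc.hasDerivAt_det hr u
    have hl : HasDerivAt (fun s : ℝ => x + s • u) u 0 := by
      simpa using ((hasDerivAt_id (0 : ℝ)).smul_const u).const_add x
    have h2 : HasFDerivAt J.det (fderiv ℝ J.det x) (x + (0 : ℝ) • u) := by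
      rw [zero_smul, add_zero]
      exact (J.contDiff_det.differentiable one_ne_zero x).hasFDerivAt
    have h3 := h2.comp_hasDerivAt (0 : ℝ) hl
    rw [Set.mem_ofPred_eq, h3.unique h1]
    refine Finset.sum_nonneg fun a _ => mul_nonneg (div_nonneg ?_ (sq_nonneg _))
      (Finset.prod_nonneg fun b hb => (hc.pos hx (Finset.mem_of_mem_erase hb)).le)
    exact inner_nonneg_of_mul_self (hc.mul_self a) hu
  have h := J.dense_isRegular.open_subset_closure_inter isOpen_cone hx
  exact closure_minimal hsub hcl h

/-- The determinant is increasing on the cone. -/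
theorem det_le_det_add {x u : V} (hx : x ∈ J.cone) (hu : u ∈ J.squares) :
    J.det x ≤ J.det (x + u) := by
  have hl (s : ℝ) : HasDerivAt (fun s : ℝ => x + s • u) u s := by
    simpa using ((hasDerivAt_id s).smul_const u).const_add x
  have hd (s : ℝ) : HasDerivAt (fun s : ℝ => J.det (x + s • u)) (fderiv ℝ J.det (x + s • u) u) s :=
    (J.contDiff_det.differentiable one_ne_zero _).hasFDerivAt.comp_hasDerivAt s (hl s)
  have hmono : MonotoneOn (fun s : ℝ => J.det (x + s • u)) (Set.Icc 0 1) := by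
    refine monotoneOn_of_deriv_nonneg (convex_Icc 0 1)
      (fun s _ => (hd s).continuousAt.continuousWithinAt)
      (fun s _ => (hd s).differentiableAt.differentiableWithinAt) fun s hs => ?_
    rw [interior_Icc] at hs
    rw [(hd s).deriv]
    refine fderiv_det_nonneg (add_mem_cone hx ?_) hu
    obtain ⟨z, rfl⟩ := hu
    refine ⟨√s • z, ?_⟩
    simp only [map_smul, LinearMap.smul_apply, smul_smul, Real.mul_self_sqrt hs.1.le]
  simpa using hmono (Set.left_mem_Icc.2 zero_le_one) (Set.right_mem_Icc.2 zero_le_one) zero_le_one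

/-- Below `x` in the cone order lies a regular element of the cone, whose determinant is a product
of positive eigenvalues; monotonicity concludes. -/
theorem det_pos {x : V} (hx : x ∈ J.cone) : 0 < J.det x := by
  have hopen : IsOpen (J.cone ∩ (fun y => x - y) ⁻¹' J.cone) :=
    isOpen_cone.inter (isOpen_cone.preimage (by fun_prop))
  have hne : (J.cone ∩ (fun y => x - y) ⁻¹' J.cone).Nonempty := by
    refine ⟨(1 / 2 : ℝ) • x, smul_mem_cone hx (by norm_num), ?_⟩
    have : x - (1 / 2 : ℝ) • x = (1 / 2 : ℝ) • x := by module
    rw [Set.mem_preimage, this]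
    exact smul_mem_cone hx (by norm_num)
  obtain ⟨y, ⟨hy1, hy2⟩, hy3⟩ := J.dense_isRegular.inter_open_nonempty _ hopen hne
  obtain ⟨c, hc⟩ := J.exists_isResolution y
  have h1 : 0 < J.det y := by
    rw [hc.det_eq hy3]
    exact Finset.prod_pos fun a ha => hc.pos hy1 ha
  have h2 := det_le_det_add hy1 (cone_subset_squares hy2)
  rw [add_sub_cancel] at h2
  exact h1.trans_le h2

end EuclideanJordanAlgebra

/-! ### Hardy space test functions and Carleson measures. -/

section Hardy

variable {V : Type*} [NormedAddCommGroup V] [InnerProductSpace ℝ V]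

namespace IsHolomorphicOn

variable {T : Set (V × V)} {F G : V × V → ℂ}

theorem const (a : ℂ) : IsHolomorphicOn (fun _ : V × V => a) T := fun z _ =>
  ⟨differentiableAt_const a, fun u v => by simp⟩

theorem mul (hF : IsHolomorphicOn F T) (hG : IsHolomorphicOn G T) :
    IsHolomorphicOn (fun z => F z * G z) T := fun z hz => by
  obtain ⟨hf, hf'⟩ := hF z hz
  obtain ⟨hg, hg'⟩ := hG z hz
  refine ⟨hf.mul hg, fun u v => ?_⟩
  rw [fderiv_fun_mul hf hg]
  simp only [_root_.add_apply, _root_.smul_apply, hf', hg', smul_eq_mul]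
  ring

theorem prod {ι : Type*} (s : Finset ι) {F : ι → V × V → ℂ}
    (hF : ∀ i ∈ s, IsHolomorphicOn (F i) T) : IsHolomorphicOn (fun z => ∏ i ∈ s, F i z) T := by
  classical
  induction s using Finset.induction_on with
  | empty => simpa using const (1 : ℂ)
  | insert i s hi ih =>
    simp only [Finset.prod_insert hi]
    exact (hF i (Finset.mem_insert_self i s)).mul
      (ih fun j hj => hF j (Finset.mem_insert_of_mem hj))

theorem continuousOn (hF : IsHolomorphicOn F T) : ContinuousOn F T := fun z hz =>
  (hF z hz).1.continuousAt.continuousWithinAt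

/-- The reciprocal of a complex affine function is holomorphic where the latter does not vanish. -/
theorem inv_affine (l : V →L[ℝ] ℝ) (a : ℂ)
    (h : ∀ z ∈ T, (l z.1 : ℂ) + Complex.I * l z.2 + a ≠ 0) :
    IsHolomorphicOn (fun z => ((l z.1 : ℂ) + Complex.I * l z.2 + a)⁻¹) T := fun z hz => by
  let L : V × V →L[ℝ] ℂ := Complex.ofRealCLM.comp (l.comp (ContinuousLinearMap.fst ℝ V V)) +
    Complex.I • Complex.ofRealCLM.comp (l.comp (ContinuousLinearMap.snd ℝ V V))
  have hL : HasFDerivAt (fun z : V × V => (l z.1 : ℂ) + Complex.I * l z.2 + a) L z :=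
    (L.hasFDerivAt (x := z)).add_const a
  have h1 := ((hasDerivAt_inv (h z hz)).hasFDerivAt.restrictScalars ℝ).comp z hL
  refine ⟨h1.differentiableAt, fun u v => ?_⟩
  have h2 : L (-v, u) = Complex.I * L (u, v) := by
    simp only [L, _root_.add_apply, _root_.smul_apply,
      ContinuousLinearMap.comp_apply, ContinuousLinearMap.coe_fst', ContinuousLinearMap.coe_snd',
      Complex.ofRealCLM_apply, smul_eq_mul, map_neg]
    linear_combination -(l v : ℂ) * Complex.I_mul_I
  have h3 := h1.fderiv
  simp only [Function.comp_def] at h3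
  rw [h3]
  simp only [ContinuousLinearMap.comp_apply, ContinuousLinearMap.coe_restrictScalars',
    ContinuousLinearMap.toSpanSingleton_apply, smul_eq_mul, h2]
  ring

end IsHolomorphicOn

/-- The function `∏ᵢ (ξᵢ(z) + i R)⁻¹` on the complexification, where the `ξᵢ` are linear
coordinates. -/
def prodInv {ι : Type*} [Fintype ι] (ξ : V ≃L[ℝ] (ι → ℝ)) (R : ℝ) (z : V × V) : ℂ :=
  ∏ i, ((ξ z.1 i : ℂ) + Complex.I * ξ z.2 i + Complex.I * R)⁻¹

theorem isHolomorphicOn_prodInv {ι : Type*} [Fintype ι] {ξ : V ≃L[ℝ] (ι → ℝ)} {Ω : Set V}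
    (hξ : ∀ y ∈ Ω, ∀ i, 0 ≤ ξ y i) {R : ℝ} (hR : 0 < R) :
    IsHolomorphicOn (prodInv ξ R) (tube Ω) := by
  refine IsHolomorphicOn.prod _ fun i _ => IsHolomorphicOn.inv_affine
    ((ContinuousLinearMap.proj i).comp (ξ : V →L[ℝ] (ι → ℝ))) (Complex.I * R) fun z hz h0 => ?_
  have h1 := congrArg Complex.im h0
  have h2 := hξ z.2 hz.2 i
  simp at h1
  linarith

variable [FiniteDimensional ℝ V] [MeasurableSpace V] [BorelSpace V]

theorem hardyNorm_sq (Ω : Set V) (F : V × V → ℂ) :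
    hardyNorm Ω F ^ 2 = ⨆ y ∈ Ω, ∫⁻ x, ‖F (x, y)‖ₑ ^ 2 := by
  rw [hardyNorm, ← ENNReal.rpow_natCast, ← ENNReal.rpow_mul]
  norm_num

theorem setLIntegral_tube_radialMeasure {Ω : Set V} (hΩ : MeasurableSet Ω) {φ : V → ℝ}
    (hφ : AEMeasurable φ (volume.restrict Ω)) {F : V × V → ℂ} (hF : ContinuousOn F (tube Ω)) :
    ∫⁻ z in tube Ω, ‖F z‖ₑ ^ 2 ∂radialMeasure Ω φ =
      ∫⁻ y in Ω, ENNReal.ofReal (φ y) * ∫⁻ x, ‖F (x, y)‖ₑ ^ 2 := by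
  classical
  have hT : MeasurableSet (tube Ω) := MeasurableSet.univ.prod hΩ
  -- `F` is arbitrary off the tube; extending by zero makes the integrand measurable for Tonelli.
  let f : V × V → ℝ≥0∞ := (tube Ω).piecewise (fun z => ‖F z‖ₑ ^ 2) 0
  have hf : Measurable f :=
    ContinuousOn.measurable_piecewise (by fun_prop) continuousOn_const hT
  have hfF (y : V) (hy : y ∈ Ω) (x : V) : f (x, y) = ‖F (x, y)‖ₑ ^ 2 :=
    Set.piecewise_eq_of_mem _ _ _ ⟨Set.mem_univ _, hy⟩
  have hres : (radialMeasure Ω φ).restrict (tube Ω) = radialMeasure Ω φ := by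
    rw [radialMeasure, tube, ← Measure.prod_restrict, Measure.restrict_univ,
      restrict_withDensity hΩ, Measure.restrict_restrict hΩ, Set.inter_self]
  rw [setLIntegral_congr_fun hT (g := f) fun z hz => (hfF z.2 hz.2 z.1).symm, hres, radialMeasure,
    lintegral_prod_symm _ hf.aemeasurable, lintegral_withDensity_eq_lintegral_mul₀
      hφ.ennreal_ofReal hf.lintegral_prod_left'.aemeasurable]
  refine setLIntegral_congr_fun hΩ fun y hy => ?_
  simp only [Pi.mul_apply, hfF y hy]

theorem isCarlesonMeasure_of_integrableOn {Ω : Set V} (hΩ : MeasurableSet Ω) {φ : V → ℝ}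
    (hφ : IntegrableOn φ Ω) : IsCarlesonMeasure Ω (radialMeasure Ω φ) := by
  have hfin : ∫⁻ y in Ω, ENNReal.ofReal (φ y) ≠ ∞ :=
    (hφ.lintegral_lt_top).ne
  -- The added `1` keeps the constant positive when the integral vanishes.
  refine ⟨(∫⁻ y in Ω, ENNReal.ofReal (φ y)).toReal + 1, by positivity, fun F hF => ?_⟩
  rw [setLIntegral_tube_radialMeasure hΩ hφ.aemeasurable hF.1.continuousOn]
  calc ∫⁻ y in Ω, ENNReal.ofReal (φ y) * ∫⁻ x, ‖F (x, y)‖ₑ ^ 2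
      ≤ ∫⁻ y in Ω, ENNReal.ofReal (φ y) * hardyNorm Ω F ^ 2 := by
        refine setLIntegral_mono' hΩ fun y hy => ?_
        rw [hardyNorm_sq]
        gcongr
        exact le_iSup₂_of_le y hy le_rfl
    _ = (∫⁻ y in Ω, ENNReal.ofReal (φ y)) * hardyNorm Ω F ^ 2 :=
        lintegral_mul_const' _ _ (ENNReal.pow_ne_top hF.2.ne)
    _ ≤ _ := by
        gcongr
        rw [ENNReal.ofReal_add ENNReal.toReal_nonneg zero_le_one, ENNReal.ofReal_toReal hfin]
        exact le_self_add

theorem lintegral_inv_sq_add_sq {a : ℝ} (ha : 0 < a) :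
    ∫⁻ u : ℝ, ENNReal.ofReal ((u ^ 2 + a ^ 2)⁻¹) = ENNReal.ofReal (Real.pi / a) := by
  have h (u : ℝ) : (u ^ 2 + a ^ 2)⁻¹ = (a ^ 2)⁻¹ * (1 + (u / a) ^ 2)⁻¹ := by
    rw [← mul_inv]
    congr 1
    field_simp
    ring
  simp only [h]
  rw [← ofReal_integral_eq_lintegral_ofReal, integral_const_mul,
    Measure.integral_comp_div (fun u => (1 + u ^ 2)⁻¹), integral_univ_inv_one_add_sq,
    abs_of_pos ha]
  · congr 1
    simp only [smul_eq_mul]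
    field_simp
  · exact (integrable_inv_one_add_sq.comp_div ha.ne').const_mul _
  · exact Filter.Eventually.of_forall fun u => by positivity

theorem lintegral_prod_inv_sq_add_sq {ι : Type*} [Fintype ι] {a : ι → ℝ} (ha : ∀ i, 0 < a i) :
    ∫⁻ u : ι → ℝ, ∏ i, ENNReal.ofReal ((u i ^ 2 + a i ^ 2)⁻¹) =
      ∏ i, ENNReal.ofReal (Real.pi / a i) := by
  have hint (i : ι) : Integrable fun u : ℝ => (u ^ 2 + a i ^ 2)⁻¹ := by
    refine (lintegral_ofReal_ne_top_iff_integrable ?_ ?_).1 ?_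
    · exact (Measurable.inv (by fun_prop)).aestronglyMeasurable
    · exact Filter.Eventually.of_forall fun u => by positivity
    · rw [lintegral_inv_sq_add_sq (ha i)]; exact ENNReal.ofReal_ne_top
  have hnn (i : ι) (u : ℝ) : 0 ≤ (u ^ 2 + a i ^ 2)⁻¹ := by positivity
  simp only [← lintegral_inv_sq_add_sq (ha _)]
  simp only [← ENNReal.ofReal_prod_of_nonneg fun i _ => hnn i _,
    ← ofReal_integral_eq_lintegral_ofReal (hint _) (Filter.Eventually.of_forall (hnn _))]
  have hprod : Integrable fun u : ι → ℝ => ∏ i, (u i ^ 2 + a i ^ 2)⁻¹ :=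
    Integrable.fintype_prod hint
  rw [← ofReal_integral_eq_lintegral_ofReal hprod
    (Filter.Eventually.of_forall fun u => Finset.prod_nonneg fun i _ => hnn i _),
    integral_fintype_prod_volume_eq_prod (fun i (u : ℝ) => (u ^ 2 + a i ^ 2)⁻¹),
    ENNReal.ofReal_prod_of_nonneg]
  exact fun i _ => integral_nonneg (hnn i)

section prodInv

variable {ι : Type*} [Fintype ι] (ξ : V ≃L[ℝ] (ι → ℝ))

/-- In the coordinates `ξ` the slice integral splits into factors `∫ du / (u² + a²) = π / a`; `K` is
the Haar scaling factor of `ξ`. -/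
theorem exists_lintegral_prodInv :
    ∃ K : ℝ≥0∞, K ≠ 0 ∧ K ≠ ∞ ∧ ∀ (R : ℝ) (y : V), (∀ i, 0 < ξ y i + R) →
      ∫⁻ x, ‖prodInv ξ R (x, y)‖ₑ ^ 2 = K * ∏ i, ENNReal.ofReal (Real.pi / (ξ y i + R)) := by
  obtain ⟨k, hk, hmap⟩ : ∃ k : NNReal, k ≠ 0 ∧ (volume : Measure V).map ξ = k • volume :=
    ⟨_, (Measure.addHaarScalarFactor_pos_of_isAddHaarMeasure _ _).ne',
      Measure.isAddLeftInvariant_eq_smul ((volume : Measure V).map ξ) volume⟩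
  refine ⟨k, by exact_mod_cast hk, ENNReal.coe_ne_top, fun R y h => ?_⟩
  · have h1 (x : V) : ‖prodInv ξ R (x, y)‖ₑ ^ 2 =
        ∏ i, ENNReal.ofReal ((ξ x i ^ 2 + (ξ y i + R) ^ 2)⁻¹) := by
      rw [← ENNReal.ofReal_prod_of_nonneg fun i _ => by positivity, ← ofReal_norm,
        ← ENNReal.ofReal_pow (norm_nonneg _), prodInv, norm_prod, ← Finset.prod_pow]
      congr 1
      refine Finset.prod_congr rfl fun i _ => ?_
      rw [norm_inv, inv_pow, ← Complex.normSq_eq_norm_sq, Complex.normSq_apply]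
      simp
      ring
    simp only [h1]
    have h2 : Measurable fun u : ι → ℝ =>
        ∏ i, ENNReal.ofReal ((u i ^ 2 + (ξ y i + R) ^ 2)⁻¹) :=
      Finset.measurable_prod _ fun i _ => (Measurable.inv (by fun_prop)).ennreal_ofReal
    rw [← lintegral_prod_inv_sq_add_sq h, ← lintegral_map h2 ξ.continuous.measurable, hmap,
      lintegral_smul_measure]
    rfl

variable {ξ} {Ω : Set V}

theorem lintegral_le_of_isCarlesonMeasure (hΩ : MeasurableSet Ω)
    (hξ : ∀ y ∈ Ω, ∀ i, 0 ≤ ξ y i) {φ : V → ℝ} (hφ : AEMeasurable φ (volume.restrict Ω))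
    (h : IsCarlesonMeasure Ω (radialMeasure Ω φ)) :
    ∫⁻ y in Ω, ENNReal.ofReal (φ y) ≠ ∞ := by
  obtain ⟨C, hC, h⟩ := h
  obtain ⟨K, hK0, hK, hint⟩ := exists_lintegral_prodInv ξ
  have hpos {R : ℝ} (hR : 0 < R) (y : V) (hy : y ∈ Ω) (i : ι) : 0 < ξ y i + R :=
    add_pos_of_nonneg_of_pos (hξ y hy i) hR
  have hbound (R : ℝ) (hR : 0 < R) :
      ∫⁻ y in Ω, ENNReal.ofReal (φ y) * ∏ i, ENNReal.ofReal (R / (ξ y i + R)) ≤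
        ENNReal.ofReal C := by
    -- `A` is the slice integral at `y = 0`, which dominates those over `Ω` because the coordinates
    -- are nonnegative there.
    set A : ℝ≥0∞ := K * ∏ _i : ι, ENNReal.ofReal (Real.pi / R) with hA
    have hA0 : A ≠ 0 := mul_ne_zero hK0 (Finset.prod_ne_zero_iff.2 fun i _ => by
      simpa using div_pos Real.pi_pos hR)
    have hAtop : A ≠ ∞ := ENNReal.mul_ne_top hK (ENNReal.prod_ne_top fun i _ => ENNReal.ofReal_ne_top)
    have hnorm : hardyNorm Ω (prodInv ξ R) ^ 2 ≤ A := by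
      rw [hardyNorm_sq]
      refine iSup₂_le fun y hy => ?_
      rw [hint R y (hpos hR y hy), hA]
      gcongr with i
      exact le_add_of_nonneg_left (hξ y hy i)
    have hmem : MemHardy Ω (prodInv ξ R) := by
      refine ⟨isHolomorphicOn_prodInv hξ hR, lt_top_iff_ne_top.2 fun htop => ?_⟩
      rw [htop] at hnorm
      exact hAtop (top_le_iff.1 (by simpa using hnorm))
    have h1 := h _ hmem
    rw [setLIntegral_tube_radialMeasure hΩ hφ hmem.1.continuousOn] at h1
    have h2 : ∫⁻ y in Ω, ENNReal.ofReal (φ y) * ∫⁻ x, ‖prodInv ξ R (x, y)‖ₑ ^ 2 =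
        A * ∫⁻ y in Ω, ENNReal.ofReal (φ y) * ∏ i, ENNReal.ofReal (R / (ξ y i + R)) := by
      rw [← lintegral_const_mul' _ _ hAtop]
      refine setLIntegral_congr_fun hΩ fun y hy => ?_
      have h3 (i : ι) : ENNReal.ofReal (Real.pi / (ξ y i + R)) =
          ENNReal.ofReal (Real.pi / R) * ENNReal.ofReal (R / (ξ y i + R)) := by
        rw [← ENNReal.ofReal_mul (by positivity)]
        congr 1
        field_simp
      simp only [hint R y (hpos hR y hy), h3, Finset.prod_mul_distrib, hA]
      ring
    rw [h2] at h1
    have h4 := h1.trans (mul_le_mul_right hnorm (ENNReal.ofReal C))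
    rw [_root_.mul_comm _ A] at h4
    exact (ENNReal.mul_le_mul_iff_right hA0 hAtop).1 h4
  refine ne_top_of_le_ne_top (b := ENNReal.ofReal C) ENNReal.ofReal_ne_top ?_
  have hlim (y : V) (hy : y ∈ Ω) : Filter.Tendsto (fun k : ℕ => ENNReal.ofReal (φ y) *
      ∏ i, ENNReal.ofReal (((k : ℝ) + 1) / (ξ y i + ((k : ℝ) + 1)))) Filter.atTop
      (nhds (ENNReal.ofReal (φ y))) := by
    have h1 (i : ι) : Filter.Tendsto (fun k : ℕ =>
        ((k : ℝ) + 1) / (ξ y i + ((k : ℝ) + 1))) Filter.atTop (nhds 1) := by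
      have h2 : Filter.Tendsto (fun k : ℕ => (k : ℝ) + 1) Filter.atTop Filter.atTop :=
        Filter.tendsto_atTop_add_const_right _ _ tendsto_natCast_atTop_atTop
      have h3 : Filter.Tendsto (fun k : ℕ => 1 - ξ y i / (ξ y i + ((k : ℝ) + 1))) Filter.atTop
          (nhds (1 - 0)) :=
        tendsto_const_nhds.sub (Filter.Tendsto.const_div_atTop
          (Filter.tendsto_atTop_add_const_left _ _ h2) _)
      rw [sub_zero] at h3
      refine h3.congr fun k => ?_
      have := hpos (R := (k : ℝ) + 1) (by positivity) y hy i
      field_simp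
      ring
    have h4 := ENNReal.tendsto_ofReal (tendsto_finsetProd Finset.univ fun i _ => h1 i)
    rw [Finset.prod_const_one, ENNReal.ofReal_one] at h4
    have h5 := ENNReal.Tendsto.const_mul (a := ENNReal.ofReal (φ y)) h4
      (Or.inr ENNReal.ofReal_ne_top)
    rw [mul_one] at h5
    refine h5.congr fun k => ?_
    rw [ENNReal.ofReal_prod_of_nonneg fun i _ => ?_]
    exact div_nonneg (by positivity) (hpos (by positivity) y hy i).le
  calc ∫⁻ y in Ω, ENNReal.ofReal (φ y)
      = ∫⁻ y in Ω, Filter.liminf (fun k : ℕ => ENNReal.ofReal (φ y) *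
          ∏ i, ENNReal.ofReal (((k : ℝ) + 1) / (ξ y i + ((k : ℝ) + 1)))) Filter.atTop :=
        setLIntegral_congr_fun hΩ fun y hy => (hlim y hy).liminf_eq.symm
    _ ≤ Filter.liminf (fun k : ℕ => ∫⁻ y in Ω, ENNReal.ofReal (φ y) *
          ∏ i, ENNReal.ofReal (((k : ℝ) + 1) / (ξ y i + ((k : ℝ) + 1)))) Filter.atTop := by
        refine lintegral_liminf_le' fun k => hφ.ennreal_ofReal.mul ?_
        refine (Finset.measurable_prod _ fun i _ => ?_).aemeasurable
        have : Measurable fun y => ξ y i := (measurable_pi_apply i).comp ξ.continuous.measurable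
        fun_prop
    _ ≤ ENNReal.ofReal C :=
        Filter.liminf_le_of_le (by isBoundedDefault) fun b hb => by
          obtain ⟨k, hk⟩ := hb.exists
          exact hk.trans (hbound _ (by positivity))

end prodInv

end Hardy

/-! ### Coordinates on the cone and the determinant bound. -/

namespace EuclideanJordanAlgebra

variable {V : Type*} [NormedAddCommGroup V] [InnerProductSpace ℝ V] [FiniteDimensional ℝ V]
variable (J : EuclideanJordanAlgebra V)

/-- There are linear coordinates that are nonnegative on the cone. -/
theorem exists_nonneg_coordinates :
    ∃ ξ : V ≃L[ℝ] (Fin (finrank ℝ V) → ℝ), ∀ y ∈ J.cone, ∀ i, 0 ≤ ξ y i := by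
  -- The squares have nonempty interior, so they contain a basis; inner products with it are the
  -- coordinates, nonnegative by self-duality.
  have hspan : Submodule.span ℝ J.squares = ⊤ :=
    Submodule.eq_top_of_nonempty_interior' _
      ⟨J.one, interior_mono Submodule.subset_span J.one_mem_cone⟩
  let b₀ := Basis.ofSpan hspan.ge
  let b : Basis (Fin (finrank ℝ V)) ℝ V := b₀.reindex (b₀.indexEquiv (finBasis ℝ V))
  have hb (i) : b i ∈ J.squares := by
    rw [Basis.reindex_apply]
    exact Basis.ofSpan_subset hspan.ge ⟨_, rfl⟩
  let l : V →ₗ[ℝ] (_ → ℝ) := LinearMap.pi fun i => innerₛₗ ℝ (b i)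
  have hl (y : V) (i) : l y i = inner ℝ (b i) y := rfl
  have hinj : Function.Injective l := by
    intro x y h
    exact InnerProductSpace.ext_inner_left_basis b fun i => congrFun h i
  have hsurj : Function.Surjective l :=
    (LinearMap.injective_iff_surjective_of_finrank_eq_finrank (by simp)).1 hinj
  refine ⟨(LinearEquiv.ofBijective l ⟨hinj, hsurj⟩).toContinuousLinearEquiv,
    fun y hy i => ?_⟩
  exact inner_nonneg_of_mem_squares (hb i) (cone_subset_squares hy)

/-- The exponent is below `1 - n/r`, and `r ≤ n`. -/
theorem exponent_neg [Nontrivial V] {α : ℝ} (hα : (finrank ℝ V : ℝ) / J.rank - 1 / 2 < α) :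
    -2 * α + (finrank ℝ V : ℝ) / J.rank < 0 := by
  have hr : (0 : ℝ) < J.rank := by exact_mod_cast J.rank_pos
  have h1 : (1 : ℝ) ≤ (finrank ℝ V : ℝ) / J.rank := by
    rw [one_le_div hr]
    exact_mod_cast J.rank_le_finrank
  linarith

variable {J}

/-- With `R = k + 1`, homogeneity turns the ratio into `Δ(R⁻¹ y + e) / Δ(e)`, and continuity at `e`
suffices. -/
theorem tendsto_det_ratio (y : V) (s : ℝ) : Filter.Tendsto (fun k : ℕ =>
    (J.det (y + ((k : ℝ) + 1) • J.one) / J.det (((k : ℝ) + 1) • J.one)) ^ s)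
    Filter.atTop (nhds 1) := by
  have hpos := (det_pos J.one_mem_cone)
  have h1 : Filter.Tendsto (fun k : ℕ => (J.det (((k : ℝ) + 1)⁻¹ • y + J.one) / J.det J.one) ^ s)
      Filter.atTop (nhds ((J.det ((0 : ℝ) • y + J.one) / J.det J.one) ^ s)) := by
    have h2 : Filter.Tendsto (fun k : ℕ => ((k : ℝ) + 1)⁻¹) Filter.atTop (nhds 0) :=
      tendsto_inv_atTop_zero.comp
        (Filter.tendsto_atTop_add_const_right _ _ tendsto_natCast_atTop_atTop)
    have h3 : Filter.Tendsto (fun k : ℕ => J.det (((k : ℝ) + 1)⁻¹ • y + J.one)) Filter.atTop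
        (nhds (J.det ((0 : ℝ) • y + J.one))) :=
      (J.contDiff_det.continuous.tendsto _).comp ((h2.smul_const y).add_const J.one)
    refine (h3.div_const _).rpow_const (Or.inl ?_)
    rw [zero_smul, zero_add]
    exact (div_pos hpos hpos).ne'
  rw [zero_smul, zero_add, div_self hpos.ne', Real.one_rpow] at h1
  refine h1.congr fun k => ?_
  have hk : (k : ℝ) + 1 ≠ 0 := by positivity
  have h4 : y + ((k : ℝ) + 1) • J.one = ((k : ℝ) + 1) • (((k : ℝ) + 1)⁻¹ • y + J.one) := by
    rw [smul_add, smul_smul, mul_inv_cancel₀ hk, one_smul]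
  rw [h4, J.det_smul _ _ hk, J.det_smul _ _ hk, mul_div_mul_left _ _ (pow_ne_zero _ hk)]

variable [MeasurableSpace V] [BorelSpace V] {φ : V → ℝ}

theorem detBound_of_integrableOn (hφ : IntegrableOn φ J.cone) (h0 : ∀ y ∈ J.cone, 0 ≤ φ y) {α : ℝ}
    (hα : -2 * α + (finrank ℝ V : ℝ) / J.rank ≤ 0) : J.DetBound φ α := by
  set s := -2 * α + (finrank ℝ V : ℝ) / J.rank with hs
  have hm := isOpen_cone (J := J).measurableSet
  refine ⟨(∫⁻ y in J.cone, ENNReal.ofReal (φ y)).toReal + 1, by positivity, fun t ht => ?_⟩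
  rw [← hs]
  have hts : 0 ≤ J.det t ^ s := Real.rpow_nonneg (det_pos ht).le s
  calc ∫⁻ y in J.cone, ENNReal.ofReal (J.det (y + t) ^ s * φ y)
      ≤ ∫⁻ y in J.cone, ENNReal.ofReal (J.det t ^ s) * ENNReal.ofReal (φ y) := by
        refine setLIntegral_mono' hm fun y hy => ?_
        rw [← ENNReal.ofReal_mul hts]
        refine ENNReal.ofReal_le_ofReal (mul_le_mul_of_nonneg_right ?_ (h0 y hy))
        rw [add_comm]
        exact Real.rpow_le_rpow_of_nonpos (det_pos ht)
          (det_le_det_add ht (cone_subset_squares hy)) hα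
    _ = ENNReal.ofReal (J.det t ^ s) * ∫⁻ y in J.cone, ENNReal.ofReal (φ y) :=
        lintegral_const_mul' _ _ ENNReal.ofReal_ne_top
    _ ≤ _ := by
        rw [_root_.mul_comm, ENNReal.ofReal_mul (by positivity),
          ENNReal.ofReal_add ENNReal.toReal_nonneg zero_le_one,
          ENNReal.ofReal_toReal hφ.lintegral_lt_top.ne]
        gcongr
        exact le_self_add

theorem lintegral_ne_top_of_detBound (hφm : AEMeasurable φ (volume.restrict J.cone)) {α : ℝ}
    (h : J.DetBound φ α) : ∫⁻ y in J.cone, ENNReal.ofReal (φ y) ≠ ∞ := by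
  obtain ⟨C, hC, h⟩ := h
  set s := -2 * α + (finrank ℝ V : ℝ) / J.rank
  have hm := isOpen_cone (J := J).measurableSet
  have hmem (k : ℕ) : ((k : ℝ) + 1) • J.one ∈ J.cone :=
    smul_mem_cone J.one_mem_cone (by positivity)
  have hratio (k : ℕ) (y : V) (hy : y ∈ J.cone) :
      (J.det (y + ((k : ℝ) + 1) • J.one) / J.det (((k : ℝ) + 1) • J.one)) ^ s * φ y =
      (J.det (((k : ℝ) + 1) • J.one) ^ s)⁻¹ * (J.det (y + ((k : ℝ) + 1) • J.one) ^ s * φ y) := by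
    rw [Real.div_rpow (det_pos (add_mem_cone hy (cone_subset_squares (hmem k)))).le
      (det_pos (hmem k)).le]
    ring
  have hbound (k : ℕ) : ∫⁻ y in J.cone, ENNReal.ofReal
      ((J.det (y + ((k : ℝ) + 1) • J.one) / J.det (((k : ℝ) + 1) • J.one)) ^ s * φ y) ≤
      ENNReal.ofReal C := by
    have hpos : 0 < J.det (((k : ℝ) + 1) • J.one) ^ s := Real.rpow_pos_of_pos (det_pos (hmem k)) s
    calc _ = ∫⁻ y in J.cone, ENNReal.ofReal (J.det (((k : ℝ) + 1) • J.one) ^ s)⁻¹ *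
          ENNReal.ofReal (J.det (y + ((k : ℝ) + 1) • J.one) ^ s * φ y) :=
          setLIntegral_congr_fun hm fun y hy => by
            rw [← ENNReal.ofReal_mul (inv_nonneg.2 hpos.le), hratio k y hy]
      _ = ENNReal.ofReal (J.det (((k : ℝ) + 1) • J.one) ^ s)⁻¹ * _ :=
          lintegral_const_mul' _ _ ENNReal.ofReal_ne_top
      _ ≤ ENNReal.ofReal (J.det (((k : ℝ) + 1) • J.one) ^ s)⁻¹ *
          ENNReal.ofReal (C * J.det (((k : ℝ) + 1) • J.one) ^ s) := by
          gcongr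
          exact h _ (hmem k)
      _ = ENNReal.ofReal C := by
          rw [← ENNReal.ofReal_mul (inv_nonneg.2 hpos.le)]
          congr 1
          field_simp
  refine ne_top_of_le_ne_top (b := ENNReal.ofReal C) ENNReal.ofReal_ne_top ?_
  have hlim (y : V) : Filter.Tendsto (fun k : ℕ => ENNReal.ofReal
      ((J.det (y + ((k : ℝ) + 1) • J.one) / J.det (((k : ℝ) + 1) • J.one)) ^ s * φ y))
      Filter.atTop (nhds (ENNReal.ofReal (φ y))) := by
    have h1 := ENNReal.tendsto_ofReal ((tendsto_det_ratio (J := J) y s).mul_const (φ y))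
    rwa [_root_.one_mul] at h1
  calc ∫⁻ y in J.cone, ENNReal.ofReal (φ y)
      = ∫⁻ y in J.cone, Filter.liminf (fun k : ℕ => ENNReal.ofReal
          ((J.det (y + ((k : ℝ) + 1) • J.one) / J.det (((k : ℝ) + 1) • J.one)) ^ s * φ y))
          Filter.atTop :=
        lintegral_congr fun y => (hlim y).liminf_eq.symm
    _ ≤ Filter.liminf (fun k : ℕ => ∫⁻ y in J.cone, ENNReal.ofReal
          ((J.det (y + ((k : ℝ) + 1) • J.one) / J.det (((k : ℝ) + 1) • J.one)) ^ s * φ y))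
          Filter.atTop := by
        refine lintegral_liminf_le' fun k => ((Measurable.aemeasurable ?_).mul hφm).ennreal_ofReal
        have : Measurable fun y => J.det (y + ((k : ℝ) + 1) • J.one) :=
          (J.contDiff_det.continuous.comp (continuous_add_const _)).measurable
        exact (this.div_const _).pow_const s
    _ ≤ ENNReal.ofReal C :=
        Filter.liminf_le_of_le (by isBoundedDefault) fun b hb => by
          obtain ⟨k, hk⟩ := hb.exists
          exact hk.trans (hbound k)

theorem integrableOn_iff (hφm : AEMeasurable φ (volume.restrict J.cone))
    (hφ : ∀ y ∈ J.cone, 0 ≤ φ y) :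
    IntegrableOn φ J.cone ↔ ∫⁻ y in J.cone, ENNReal.ofReal (φ y) ≠ ∞ :=
  (lintegral_ofReal_ne_top_iff_integrable hφm.aestronglyMeasurable
    ((ae_restrict_iff' isOpen_cone.measurableSet).2 (Filter.Eventually.of_forall hφ))).symm

end EuclideanJordanAlgebra

end

theorem mainTheorem1 {V : Type*} [NormedAddCommGroup V] [InnerProductSpace ℝ V]
    [FiniteDimensional ℝ V] [MeasurableSpace V] [BorelSpace V]
    (J : EuclideanJordanAlgebra V) (hJ : J.IsSimple)
    (φ : V → ℝ) (hφm : AEMeasurable φ (volume.restrict J.cone)) (hφ : ∀ y ∈ J.cone, 0 ≤ φ y) :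
    List.TFAE [
      IsCarlesonMeasure J.cone (radialMeasure J.cone φ),
      IntegrableOn φ J.cone,
      ∃ α : ℝ, (finrank ℝ V : ℝ) / J.rank - 1 / 2 < α ∧ J.DetBound φ α,
      ∀ α : ℝ, (finrank ℝ V : ℝ) / J.rank - 1 / 2 < α → J.DetBound φ α] := by
  have : Nontrivial V := hJ.1
  have hm : MeasurableSet J.cone := EuclideanJordanAlgebra.isOpen_cone.measurableSet
  have hiff := J.integrableOn_iff hφm hφ
  tfae_have 1 → 2 := fun h => by
    obtain ⟨ξ, hξ⟩ := J.exists_nonneg_coordinates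
    exact hiff.2 (lintegral_le_of_isCarlesonMeasure hm hξ hφm h)
  tfae_have 2 → 1 := isCarlesonMeasure_of_integrableOn hm
  tfae_have 2 → 4 := fun h α hα =>
    EuclideanJordanAlgebra.detBound_of_integrableOn h hφ (J.exponent_neg hα).le
  tfae_have 4 → 3 := fun h => ⟨_, lt_add_one _, h _ (lt_add_one _)⟩
  tfae_have 3 → 2 := fun ⟨_, _, h⟩ =>
    hiff.2 (EuclideanJordanAlgebra.lintegral_ne_top_of_detBound hφm h)
  tfae_finish
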